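/- Let $a_1,\dots,a_m\sim\mathcal N(0,I_n)$ be independent standard Gaussian vectors in $\mathbb R^n$, let $x\in\mathbb R^n$ be a fixed nonzero vector, put $y_k=|a_k^\top x|^2$ and $y=(y_1,\dots,y_m)^\top$, and consider the loss function $$f(z)=\frac{1}{2m}\sum_{k=1}^m\left((a_k^\top z)^2-(a_k^\top x)^2\right)^2 h\!\left(\frac{|a_k^\top z|^2}{\|z\|^2}\right)h\!\left(\frac{m|a_k^\top x|^2}{\|y\|_1}\right).$$ Here the activation function $h:[0,\infty)\to\mathbb R$ satisfies $h=1$ on $[0,\beta]$, $h\in[0,1]$ on $(\beta,\gamma)$, $h=0$ on $[\gamma,\infty)$, it is twice differentiable, and $|h'|,|h''|\le M$. The parameters satisfy $\gamma=\kappa\beta$, where $\kappa>1$ and $M$ are absolute constants. For all $\kappa>1$ and $M$ there is $\beta_0>1$ such that for every $\beta\ge\beta_0$ and $\gamma=\kappa\beta$ there are constants $C,c>0$, depending only on $\kappa$, $M$ and $\beta$, with the following property. For every such $h$, all $n$ and $m$ with $m\ge Cn$, and every nonzero $x\in\mathbb R^n$, with probability at least $1-e^{-cm}$ the function $f$ is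 twice differentiable at every point of $$\mathcal R_1=\left\{z\in\mathbb R^n:\ \min\{\|z-x\|,\|z+x\|\}\le\tfrac15\|x\|\right\},$$ and $$\lambda_{\min}\left(\nabla^2 f(z)\right)\ge\tfrac1{25}\|x\|^2\qquad\text{holds simultaneously for all } z\in\mathcal R_1.$$ Consequently, on the same event, $f$ is strongly convex with modulus $\tfrac1{25}\|x\|^2$ on each of the two closed balls of radius $\tfrac15\|x\|$ centred at $x$ and at $-x$, that is, $f-\tfrac{1}{50}\|x\|^2\|\cdot\|^2$ is convex there. -/

import Mathlib

open MeasureTheory ProbabilityTheory Topology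

noncomputable section

namespace PhaseRetrieval

/-- `h` is an activation function with parameters `β`, `γ` whose first two derivatives exist and
are bounded by `M`. Only the values of `h` on `[0, ∞)` matter. Since `h = 1` on `[0, β]`, its
(one-sided) derivatives at the endpoint `0` are automatically `0`, so the derivative conditions
are imposed at `u > 0`. -/
structure IsActivation (β γ M : ℝ) (h : ℝ → ℝ) : Prop where
  eq_one : ∀ u, 0 ≤ u → u ≤ β → h u = 1
  mem_Icc : ∀ u, β < u → u < γ → h u ∈ Set.Icc (0 : ℝ) 1
  eq_zero : ∀ u, γ ≤ u → h u = 0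
  differentiableAt : ∀ u, 0 < u → DifferentiableAt ℝ h u
  differentiableAt_deriv : ∀ u, 0 < u → DifferentiableAt ℝ (deriv h) u
  abs_deriv_le : ∀ u, 0 < u → |deriv h u| ≤ M
  abs_deriv_deriv_le : ∀ u, 0 < u → |deriv (deriv h) u| ≤ M

variable {m n : ℕ}

/-- The measurements `y k = |⟨a k, x⟩|²`. -/
def measurement (a : Fin m → EuclideanSpace ℝ (Fin n)) (x : EuclideanSpace ℝ (Fin n)) :
    Fin m → ℝ :=
  fun k => |inner ℝ (a k) x| ^ 2

/-- The loss function
`f(z) = 1/(2m) ∑ₖ (⟨aₖ,z⟩² - ⟨aₖ,x⟩²)² h(|⟨aₖ,z⟩|²/‖z‖²) h(m|⟨aₖ,x⟩|²/‖y‖₁)`. -/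
def loss (h : ℝ → ℝ) (a : Fin m → EuclideanSpace ℝ (Fin n)) (x z : EuclideanSpace ℝ (Fin n)) :
    ℝ :=
  1 / (2 * (m : ℝ)) * ∑ k,
    ((inner ℝ (a k) z) ^ 2 - (inner ℝ (a k) x) ^ 2) ^ 2
      * h (|inner ℝ (a k) z| ^ 2 / ‖z‖ ^ 2)
      * h ((m : ℝ) * |inner ℝ (a k) x| ^ 2 / ∑ j, |measurement a x j|)

/-- The distance up to a global sign, `min {‖z - x‖, ‖z + x‖}`. -/
def signDist (z x : EuclideanSpace ℝ (Fin n)) : ℝ := min ‖z - x‖ ‖z + x‖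

/-- The region `{z : dist(z, x) ≤ ‖x‖ / 5}`. -/
def regionOne (x : EuclideanSpace ℝ (Fin n)) : Set (EuclideanSpace ℝ (Fin n)) :=
  {z | signDist z x ≤ 1 / 5 * ‖x‖}

/-- `F` is twice (Fréchet) differentiable at `z`. -/
def TwiceDifferentiableAt (F : EuclideanSpace ℝ (Fin n) → ℝ) (z : EuclideanSpace ℝ (Fin n)) :
    Prop :=
  (∀ᶠ w in 𝓝 z, DifferentiableAt ℝ F w) ∧ DifferentiableAt ℝ (fderiv ℝ F) z

/-- The Hessian matrix of second partial derivatives. -/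
def hessian (F : EuclideanSpace ℝ (Fin n) → ℝ) (z : EuclideanSpace ℝ (Fin n)) :
    Matrix (Fin n) (Fin n) ℝ :=
  Matrix.of fun i j =>
    fderiv ℝ (fderiv ℝ F) z (EuclideanSpace.single i 1) (EuclideanSpace.single j 1)

/-- The smallest eigenvalue. It is used for symmetric matrices of positive size, whose real
spectrum is a nonempty finite set, so that the infimum is a minimum. -/
def lambdaMin (A : Matrix (Fin n) (Fin n) ℝ) : ℝ := sInf (spectrum ℝ A)

end PhaseRetrieval

end

/-! Normalise ‖x‖ = 1 and, for a unit vector v, put p = ⟨a, z⟩, q = ⟨a, v⟩, s = ⟨a, x⟩, d = ⟨a, z -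
x⟩. Where both cutoffs are locally 1, a summand has second derivative 4q²(3p² - s²), which by
completing the square is at least 4q²s² - 24q²d². The first term has mean 4(1 + 2⟨x, v⟩²) ≥ 4. The
second is at most (24/50)(q⁴ + (5d)⁴), of mean at most 2.88 because ‖z - x‖ ≤ 1/5. The gap exceeds
2/25, which the prefactor 1/(2m) turns into 1/25.

Fourth powers of Gaussians have no exponential moments, so everything is truncated at a level σ with
β = 32σ⁴. The weight s² becomes min(s², 4σ²), fourth powers become squares of Huber functions, and
all that remains, including every term with a derivative of h, is charged to projections of size at
least 2σ (`termSecond_lower`). At most δm of the projections in a given direction are that large,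
with δ of order σ⁻²⁴, while the coefficients of these errors grow like σ²⁰. Hence they are
negligible once β is large.

Uniformity in z and v needs no net. The exponential of the empirical sum is integrated over a ball
of directions; Fubini and Markov bound the integral, and a midpoint inequality recovers the value at
each centre at the price of n log(R/ρ), which m ≥ Cn absorbs (`exists_uniform_exp_bound`). For the
upper bounds the midpoint inequality is convexity (`exists_uniform_upper`); for the quadratic form
bounded below it is the parallelogram law (`exists_uniform_lower`). On the resulting event
`IsRegular` the rest is deterministic (`IsRegular.le_second_deriv`). -/

namespace PhaseRetrieval

/-! ### Second derivatives, the Hessian and strong convexity. -/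

section TwiceDifferentiable

variable {n : ℕ} {F G : EuclideanSpace ℝ (Fin n) → ℝ} {z : EuclideanSpace ℝ (Fin n)}

lemma TwiceDifferentiableAt.of_contDiffAt (hF : ContDiffAt ℝ 2 F z) :
    TwiceDifferentiableAt F z := by
  refine ⟨?_, (hF.fderiv_right (m := 1) (by norm_num)).differentiableAt (by norm_num)⟩
  filter_upwards [hF.eventually (by simp)] with w hw
  exact hw.differentiableAt (by norm_num)

/-- The second derivative of h need not be continuous, so `ContDiffAt` is too strong for the loss;
products, sums and compositions are treated directly. -/
lemma TwiceDifferentiableAt.mul (hF : TwiceDifferentiableAt F z)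
    (hG : TwiceDifferentiableAt G z) : TwiceDifferentiableAt (fun w => F w * G w) z := by
  refine ⟨?_, ?_⟩
  · filter_upwards [hF.1, hG.1] with w h1 h2 using h1.mul h2
  · have hd : DifferentiableAt ℝ (fun w => F w • fderiv ℝ G w + G w • fderiv ℝ F w) z :=
      (hF.1.self_of_nhds.smul hG.2).add (hG.1.self_of_nhds.smul hF.2)
    refine hd.congr_of_eventuallyEq ?_
    filter_upwards [hF.1, hG.1] with w h1 h2
    exact fderiv_fun_mul h1 h2

lemma TwiceDifferentiableAt.sum {ι : Type*} {s : Finset ι}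
    {F : ι → EuclideanSpace ℝ (Fin n) → ℝ} (hF : ∀ i ∈ s, TwiceDifferentiableAt (F i) z) :
    TwiceDifferentiableAt (fun w => ∑ i ∈ s, F i w) z := by
  have h1 : ∀ᶠ w in 𝓝 z, ∀ i ∈ s, DifferentiableAt ℝ (F i) w :=
    (Filter.eventually_all_finset s).2 fun i hi => (hF i hi).1
  refine ⟨?_, ?_⟩
  · filter_upwards [h1] with w hw using DifferentiableAt.fun_sum hw
  · have hd : DifferentiableAt ℝ (fun w => ∑ i ∈ s, fderiv ℝ (F i) w) z :=
      DifferentiableAt.fun_sum fun i hi => (hF i hi).2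
    refine hd.congr_of_eventuallyEq ?_
    filter_upwards [h1] with w hw
    exact fderiv_fun_sum hw

lemma TwiceDifferentiableAt.comp {H : ℝ → ℝ} (hH : Differentiable ℝ H)
    (hH' : Differentiable ℝ (deriv H)) (hF : TwiceDifferentiableAt F z) :
    TwiceDifferentiableAt (fun w => H (F w)) z := by
  refine ⟨?_, ?_⟩
  · filter_upwards [hF.1] with w h1 using (hH _).comp w h1
  · have hd : DifferentiableAt ℝ (fun w => deriv H (F w) • fderiv ℝ F w) z :=
      ((hH' _).comp z hF.1.self_of_nhds).smul hF.2
    refine hd.congr_of_eventuallyEq ?_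
    filter_upwards [hF.1] with w h1
    exact ((hH (F w)).hasDerivAt.comp_hasFDerivAt w h1.hasFDerivAt).fderiv

lemma TwiceDifferentiableAt.hasDerivAt_line (hF : TwiceDifferentiableAt F z)
    (v : EuclideanSpace ℝ (Fin n)) :
    HasDerivAt (fun t : ℝ => fderiv ℝ F (z + t • v) v) (fderiv ℝ (fderiv ℝ F) z v v) 0 := by
  have hl : HasDerivAt (fun t : ℝ => z + t • v) v 0 := by
    simpa using ((hasDerivAt_id (0 : ℝ)).smul_const v).const_add z
  have h2 : HasFDerivAt (fderiv ℝ F) (fderiv ℝ (fderiv ℝ F) z) (z + (0 : ℝ) • v) := by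
    simpa using hF.2.hasFDerivAt
  have h3 := h2.comp_hasDerivAt (0 : ℝ) hl
  simpa using h3.clm_apply (hasDerivAt_const (0 : ℝ) v)

lemma TwiceDifferentiableAt.eventually_hasDerivAt_line (hF : TwiceDifferentiableAt F z)
    (v : EuclideanSpace ℝ (Fin n)) :
    ∀ᶠ t : ℝ in 𝓝 0, HasDerivAt (fun s : ℝ => F (z + s • v)) (fderiv ℝ F (z + t • v) v) t := by
  have hc : Filter.Tendsto (fun t : ℝ => z + t • v) (𝓝 0) (𝓝 z) := by
    have : Continuous fun t : ℝ => z + t • v := by fun_prop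
    simpa using this.tendsto 0
  filter_upwards [hc.eventually hF.1] with t ht
  have hl : HasDerivAt (fun t : ℝ => z + t • v) v t := by
    simpa using ((hasDerivAt_id t).smul_const v).const_add z
  exact ht.hasFDerivAt.comp_hasDerivAt t hl

/-- The second derivative in direction `v` is the second derivative along the line. -/
lemma TwiceDifferentiableAt.fderiv_fderiv_apply_eq (hF : TwiceDifferentiableAt F z)
    (v : EuclideanSpace ℝ (Fin n)) {g : ℝ → ℝ} {g' : ℝ}
    (h1 : ∀ᶠ t : ℝ in 𝓝 0, HasDerivAt (fun s : ℝ => F (z + s • v)) (g t) t)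
    (h2 : HasDerivAt g g' 0) : fderiv ℝ (fderiv ℝ F) z v v = g' := by
  refine (hF.hasDerivAt_line v).unique (h2.congr_of_eventuallyEq ?_)
  filter_upwards [h1, hF.eventually_hasDerivAt_line v] with t h3 h4
  exact h4.unique h3

lemma TwiceDifferentiableAt.isSymm_hessian (hF : TwiceDifferentiableAt F z) :
    (hessian F z).IsSymm := by
  ext i j
  simp only [hessian, Matrix.transpose_apply, Matrix.of_apply]
  exact second_derivative_symmetric_of_eventually
    (hF.1.mono fun w hw => hw.hasFDerivAt) hF.2.hasFDerivAt _ _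

lemma hessian_quadratic (v : EuclideanSpace ℝ (Fin n)) :
    (v : Fin n → ℝ) ⬝ᵥ (hessian F z).mulVec v = fderiv ℝ (fderiv ℝ F) z v v := by
  have hv : v = ∑ i, v i • EuclideanSpace.single i (1 : ℝ) := by
    have := (EuclideanSpace.basisFun (Fin n) ℝ).sum_repr v
    simpa using this.symm
  have : fderiv ℝ (fderiv ℝ F) z v v = fderiv ℝ (fderiv ℝ F) z
      (∑ i, v i • EuclideanSpace.single i (1 : ℝ)) (∑ i, v i • EuclideanSpace.single i (1 : ℝ)) := by
    rw [← hv]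
  rw [this]
  simp only [dotProduct, Matrix.mulVec, hessian, Matrix.of_apply, map_sum, map_smul,
    _root_.sum_apply, _root_.smul_apply, smul_eq_mul, Finset.mul_sum]
  rw [Finset.sum_comm]
  exact Finset.sum_congr rfl fun _ _ => Finset.sum_congr rfl fun _ _ => by ring

/-- Unit eigenvectors test every eigenvalue. `NeZero n` makes the spectrum nonempty, so that `sInf`
does not take its default value. -/
lemma le_lambdaMin_hessian [NeZero n] (hF : TwiceDifferentiableAt F z) {μ : ℝ}
    (h : ∀ v, μ * ‖v‖ ^ 2 ≤ fderiv ℝ (fderiv ℝ F) z v v) : μ ≤ lambdaMin (hessian F z) := by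
  have hH : (hessian F z).IsHermitian := by
    have := hF.isSymm_hessian
    rwa [Matrix.IsHermitian, Matrix.conjTranspose_eq_transpose_of_trivial]
  refine le_csInf ?_ ?_
  · rw [hH.spectrum_real_eq_range_eigenvalues]
    exact ⟨_, ⟨0, rfl⟩⟩
  · rw [hH.spectrum_real_eq_range_eigenvalues]
    rintro _ ⟨i, rfl⟩
    have h1 := h (hH.eigenvectorBasis i)
    rw [← hessian_quadratic, hH.mulVec_eigenvectorBasis] at h1
    have h2 : ((hH.eigenvectorBasis i : EuclideanSpace ℝ (Fin n)) : Fin n → ℝ) ⬝ᵥ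
        ((hH.eigenvectorBasis i : EuclideanSpace ℝ (Fin n)) : Fin n → ℝ) = 1 := by
      have := EuclideanSpace.real_norm_sq_eq (hH.eigenvectorBasis i)
      rw [hH.eigenvectorBasis.orthonormal.1 i] at this
      simp only [dotProduct, ← sq]
      rw [← this]; norm_num
    rw [dotProduct_smul, h2, hH.eigenvectorBasis.orthonormal.1 i] at h1
    simpa using h1

/-- On each segment the function minus μ/2 ‖·‖² has a derivative `k` with nonnegative derivative,
hence a monotone one. -/
lemma strongConvexOn_of_second_deriv {s : Set (EuclideanSpace ℝ (Fin n))} (hs : Convex ℝ s)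
    {μ : ℝ} (hF : ∀ z ∈ s, TwiceDifferentiableAt F z)
    (h : ∀ z ∈ s, ∀ v, μ * ‖v‖ ^ 2 ≤ fderiv ℝ (fderiv ℝ F) z v v) : StrongConvexOn s μ F := by
  rw [strongConvexOn_iff_convex]
  set G : EuclideanSpace ℝ (Fin n) → ℝ := fun z => F z - μ / 2 * ‖z‖ ^ 2 with hG
  refine ⟨hs, fun p hp q hq a b ha hb hab => ?_⟩
  set v := q - p with hv
  set g : ℝ → ℝ := fun t => G (p + t • v) with hg
  have hmem : ∀ t ∈ Set.Icc (0 : ℝ) 1, p + t • v ∈ s := by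
    intro t ht
    have := hs.add_smul_sub_mem hp hq ht
    exact this
  set k : ℝ → ℝ := fun t => fderiv ℝ F (p + t • v) v - μ * (inner ℝ p v + t * ‖v‖ ^ 2) with hk
  have hline : ∀ t : ℝ, HasDerivAt (fun t : ℝ => p + t • v) v t := fun t => by
    simpa using ((hasDerivAt_id t).smul_const v).const_add p
  have hg1 : ∀ t ∈ Set.Icc (0 : ℝ) 1, HasDerivAt g (k t) t := by
    intro t ht
    have h1 : HasDerivAt (fun t : ℝ => F (p + t • v)) (fderiv ℝ F (p + t • v) v) t :=
      (hF _ (hmem t ht)).1.self_of_nhds.hasFDerivAt.comp_hasDerivAt t (hline t)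
    have h2 := ((hline t).norm_sq).const_mul (μ / 2)
    refine (h1.sub h2).congr_deriv ?_
    simp only [hk, inner_add_left, real_inner_smul_left, real_inner_self_eq_norm_sq]
    ring
  have hk1 : ∀ t ∈ Set.Icc (0 : ℝ) 1, HasDerivAt k
      (fderiv ℝ (fderiv ℝ F) (p + t • v) v v - μ * ‖v‖ ^ 2) t := by
    intro t ht
    have h1 : HasDerivAt (fun t : ℝ => fderiv ℝ F (p + t • v) v)
        (fderiv ℝ (fderiv ℝ F) (p + t • v) v v) t := by
      have h3 := (hF _ (hmem t ht)).2.hasFDerivAt.comp_hasDerivAt t (hline t)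
      simpa using h3.clm_apply (hasDerivAt_const t v)
    have h2 : HasDerivAt (fun t : ℝ => μ * (inner ℝ p v + t * ‖v‖ ^ 2)) (μ * ‖v‖ ^ 2) t := by
      simpa using (((hasDerivAt_id t).mul_const (‖v‖ ^ 2)).const_add (inner ℝ p v)).const_mul μ
    exact h1.sub h2
  have hmono : MonotoneOn k (Set.Icc 0 1) := by
    refine monotoneOn_of_deriv_nonneg (convex_Icc 0 1)
      (fun t ht => (hk1 t ht).continuousAt.continuousWithinAt) ?_ ?_
    · rw [interior_Icc]
      exact fun t ht => (hk1 t (Set.Ioo_subset_Icc_self ht)).differentiableAt.differentiableWithinAt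
    · rw [interior_Icc]
      intro t ht
      rw [(hk1 t (Set.Ioo_subset_Icc_self ht)).deriv]
      exact sub_nonneg.2 (h _ (hmem t (Set.Ioo_subset_Icc_self ht)) v)
  have hconv : ConvexOn ℝ (Set.Icc 0 1) g := by
    refine MonotoneOn.convexOn_of_deriv (convex_Icc 0 1)
      (fun t ht => (hg1 t ht).continuousAt.continuousWithinAt) ?_ ?_
    · rw [interior_Icc]
      exact fun t ht => (hg1 t (Set.Ioo_subset_Icc_self ht)).differentiableAt.differentiableWithinAt
    · rw [interior_Icc]
      intro t ht u hu htu
      rw [(hg1 t (Set.Ioo_subset_Icc_self ht)).deriv, (hg1 u (Set.Ioo_subset_Icc_self hu)).deriv]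
      exact hmono (Set.Ioo_subset_Icc_self ht) (Set.Ioo_subset_Icc_self hu) htu
  have key := hconv.2 (Set.left_mem_Icc.2 zero_le_one) (Set.right_mem_Icc.2 zero_le_one) ha hb hab
  have e1 : p + (a • (0 : ℝ) + b • (1 : ℝ)) • v = a • p + b • q := by
    rw [show a = 1 - b by linarith, hv]
    simp only [smul_eq_mul, mul_zero, mul_one, zero_add, smul_sub, sub_smul, one_smul]
    abel
  simp only [hg, e1] at key
  simpa [hv] using key

end TwiceDifferentiable

/-! ### Extension of the activation function to the whole line. -/

section Cutoff

/-- A twice differentiable cutoff function on the whole line. -/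
structure IsSmoothCutoff (β γ M : ℝ) (H : ℝ → ℝ) : Prop where
  differentiable : Differentiable ℝ H
  differentiable_deriv : Differentiable ℝ (deriv H)
  eq_one : ∀ u, u ≤ β → H u = 1
  eq_zero : ∀ u, γ ≤ u → H u = 0
  nonneg : ∀ u, 0 ≤ H u
  le_one : ∀ u, H u ≤ 1
  abs_deriv_le : ∀ u, |deriv H u| ≤ M
  abs_deriv_deriv_le : ∀ u, |deriv (deriv H) u| ≤ M

/-- The extension of an activation function by `1` to the negative half-line. -/
noncomputable def extendOne (h : ℝ → ℝ) : ℝ → ℝ := fun u => if u ≤ 0 then 1 else h u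

lemma IsActivation.extendOne_eq {β γ M : ℝ} {h : ℝ → ℝ} (hβ : 0 < β)
    (hh : IsActivation β γ M h) {u : ℝ} (hu : 0 ≤ u) : extendOne h u = h u := by
  unfold extendOne
  split_ifs with h0
  · rw [le_antisymm h0 hu, hh.eq_one 0 le_rfl hβ.le]
  · rfl

/-- The open sets u < β and u > 0 cover the line; the extension is constant on the first and equals
h on the second. -/
lemma IsActivation.isSmoothCutoff_extendOne {β γ M : ℝ} {h : ℝ → ℝ} (hβ : 0 < β) (hγ : β < γ)
    (hh : IsActivation β γ M h) : IsSmoothCutoff β γ M (extendOne h) := by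
  have hM : 0 ≤ M := (abs_nonneg _).trans (hh.abs_deriv_le 1 one_pos)
  have h1 : ∀ u ≤ β, extendOne h u = 1 := by
    intro u hu
    unfold extendOne
    split_ifs with h0
    · rfl
    · exact hh.eq_one u (not_le.1 h0).le hu
  have elow : ∀ u < β, extendOne h =ᶠ[𝓝 u] fun _ => 1 := fun u hu => by
    filter_upwards [Iio_mem_nhds hu] with w hw using h1 w (le_of_lt hw)
  have ehigh : ∀ u > 0, extendOne h =ᶠ[𝓝 u] h := fun u hu => by
    filter_upwards [Ioi_mem_nhds hu] with w hw
    simp [extendOne, not_le.2 (Set.mem_Ioi.1 hw)]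
  have dlow : ∀ u < β, deriv (extendOne h) =ᶠ[𝓝 u] fun _ => 0 := fun u hu => by
    filter_upwards [Iio_mem_nhds hu] with w hw
    rw [(elow w hw).deriv_eq]; simp
  have dhigh : ∀ u > 0, deriv (extendOne h) =ᶠ[𝓝 u] deriv h := fun u hu => by
    filter_upwards [Ioi_mem_nhds hu] with w hw using (ehigh w hw).deriv_eq
  have hval : ∀ u, extendOne h u ∈ Set.Icc (0 : ℝ) 1 := by
    intro u
    rcases le_or_gt u β with hu | hu
    · rw [h1 u hu]; simp
    · rw [hh.extendOne_eq hβ (hβ.trans hu).le]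
      rcases lt_or_ge u γ with hu' | hu'
      · exact hh.mem_Icc u hu hu'
      · rw [hh.eq_zero u hu']; simp
  refine ⟨fun u => ?_, fun u => ?_, h1, fun u hu => ?_, fun u => (hval u).1, fun u => (hval u).2,
    fun u => ?_, fun u => ?_⟩
  · rcases lt_or_ge u β with hu | hu
    · exact (differentiableAt_const _).congr_of_eventuallyEq (elow u hu)
    · exact (hh.differentiableAt u (hβ.trans_le hu)).congr_of_eventuallyEq
        (ehigh u (hβ.trans_le hu))
  · rcases lt_or_ge u β with hu | hu
    · exact (differentiableAt_const _).congr_of_eventuallyEq (dlow u hu)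
    · exact (hh.differentiableAt_deriv u (hβ.trans_le hu)).congr_of_eventuallyEq
        (dhigh u (hβ.trans_le hu))
  · rw [hh.extendOne_eq hβ ((hβ.trans hγ).le.trans hu), hh.eq_zero u hu]
  · rcases lt_or_ge u β with hu | hu
    · rw [(dlow u hu).self_of_nhds]; simpa
    · rw [(dhigh u (hβ.trans_le hu)).self_of_nhds]; exact hh.abs_deriv_le u (hβ.trans_le hu)
  · rcases lt_or_ge u β with hu | hu
    · rw [(dlow u hu).deriv_eq]; simpa
    · rw [(dhigh u (hβ.trans_le hu)).deriv_eq]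
      exact hh.abs_deriv_deriv_le u (hβ.trans_le hu)

variable {β γ M : ℝ} {H : ℝ → ℝ}

/-- This confines the derivative terms of the Hessian to β ≤ u ≤ γ, hence to large projections. -/
lemma IsSmoothCutoff.deriv_eq_zero (hH : IsSmoothCutoff β γ M H) {u : ℝ}
    (hu : u < β ∨ γ < u) : deriv H u = 0 ∧ deriv (deriv H) u = 0 := by
  have key : ∀ c : ℝ, (∀ᶠ w in 𝓝 u, H w = c) → deriv H u = 0 ∧ deriv (deriv H) u = 0 := by
    intro c hc
    have h2 : deriv H =ᶠ[𝓝 u] fun _ => 0 := by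
      filter_upwards [hc.eventually_nhds] with w hw
      rw [Filter.EventuallyEq.deriv_eq (f₁ := H) (f := fun _ => c) hw]; simp
    exact ⟨h2.self_of_nhds, by rw [h2.deriv_eq]; simp⟩
  rcases hu with hu | hu
  · exact key 1 (by filter_upwards [Iio_mem_nhds hu] with w hw using hH.eq_one w (le_of_lt hw))
  · exact key 0 (by filter_upwards [Ioi_mem_nhds hu] with w hw using hH.eq_zero w (le_of_lt hw))

end Cutoff

/-! ### Moments of Gaussian projections. -/

section GaussianMoments

lemma map_inner_stdGaussian {n : ℕ} (w : EuclideanSpace ℝ (Fin n)) :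
    (stdGaussian (EuclideanSpace ℝ (Fin n))).map (fun a => inner ℝ a w) =
      (gaussianReal 0 1).map (fun t => ‖w‖ * t) := by
  have h := IsGaussian.map_eq_gaussianReal (μ := stdGaussian (EuclideanSpace ℝ (Fin n)))
    (innerSL ℝ w)
  rw [integral_strongDual_stdGaussian, variance_dual_stdGaussian, innerSL_apply_norm] at h
  rw [gaussianReal_map_const_mul]
  have e : (fun a : EuclideanSpace ℝ (Fin n) => inner ℝ a w) = ⇑(innerSL ℝ w) := by
    ext a; simp [real_inner_comm]
  rw [e, h]
  congr 1
  · simp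
  · ext; simp [Real.coe_toNNReal _ (sq_nonneg ‖w‖)]

lemma integral_inner_stdGaussian {n : ℕ} (w : EuclideanSpace ℝ (Fin n)) {f : ℝ → ℝ}
    (hf : Measurable f) :
    ∫ a, f (inner ℝ a w) ∂stdGaussian (EuclideanSpace ℝ (Fin n)) =
      ∫ t, f (‖w‖ * t) ∂gaussianReal 0 1 := by
  rw [← integral_map (φ := fun a => inner ℝ a w) (by fun_prop) hf.aestronglyMeasurable,
    map_inner_stdGaussian, integral_map (by fun_prop) hf.aestronglyMeasurable]

lemma lintegral_inner_stdGaussian {n : ℕ} (w : EuclideanSpace ℝ (Fin n)) {f : ℝ → ENNReal}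
    (hf : Measurable f) :
    ∫⁻ a, f (inner ℝ a w) ∂stdGaussian (EuclideanSpace ℝ (Fin n)) =
      ∫⁻ t, f (‖w‖ * t) ∂gaussianReal 0 1 := by
  rw [← lintegral_map (g := fun a => inner ℝ a w) hf (by fun_prop),
    map_inner_stdGaussian, lintegral_map hf (by fun_prop)]

lemma integrable_pow_gaussianReal (p : ℕ) :
    Integrable (fun t : ℝ => t ^ p) (gaussianReal 0 1) := by
  have h := (memLp_id_gaussianReal (μ := 0) (v := 1) p).integrable_norm_pow'
  refine h.mono' (by fun_prop) (Filter.Eventually.of_forall fun t => ?_)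
  simp

/-- The fourth derivative at 0 of the moment generating function exp(t²/2). -/
lemma integral_pow_four_gaussianReal : ∫ t : ℝ, t ^ 4 ∂gaussianReal 0 1 = 3 := by
  have h0 : (0 : ℝ) ∈ interior (integrableExpSet (fun t : ℝ => t) (gaussianReal 0 1)) := by simp
  have h := iteratedDeriv_mgf_zero h0 4
  have hexp : ∀ t : ℝ, HasDerivAt (fun t : ℝ => Real.exp (t ^ 2 / 2)) (t * Real.exp (t ^ 2 / 2)) t := by
    intro t
    have := (((hasDerivAt_id t).pow 2).div_const 2).exp
    refine this.congr_deriv ?_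
    simp; ring
  have hd1 : deriv (fun t : ℝ => Real.exp (t ^ 2 / 2)) = fun t => t * Real.exp (t ^ 2 / 2) :=
    funext fun t => (hexp t).deriv
  have hd2 : deriv (fun t : ℝ => t * Real.exp (t ^ 2 / 2)) =
      fun t => (1 + t ^ 2) * Real.exp (t ^ 2 / 2) := funext fun t => by
    have := ((hasDerivAt_id t).mul (hexp t)).deriv
    simp only [id] at this
    refine Eq.trans this ?_
    ring
  have hd3 : deriv (fun t : ℝ => (1 + t ^ 2) * Real.exp (t ^ 2 / 2)) =
      fun t => (3 * t + t ^ 3) * Real.exp (t ^ 2 / 2) := funext fun t => by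
    have := ((((hasDerivAt_id t).pow 2).const_add 1).mul (hexp t)).deriv
    refine Eq.trans this ?_
    simp; ring
  have hd4 : deriv (fun t : ℝ => (3 * t + t ^ 3) * Real.exp (t ^ 2 / 2)) =
      fun t => (3 + 6 * t ^ 2 + t ^ 4) * Real.exp (t ^ 2 / 2) := funext fun t => by
    have := ((((hasDerivAt_id t).const_mul 3).add ((hasDerivAt_id t).pow 3)).mul (hexp t)).deriv
    refine Eq.trans this ?_
    simp; ring
  have e : mgf (fun t : ℝ => t) (gaussianReal 0 1) = fun t => Real.exp (t ^ 2 / 2) := by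
    ext t
    rw [mgf_fun_id_gaussianReal]
    simp
  rw [e, iteratedDeriv_succ, iteratedDeriv_succ, iteratedDeriv_succ, iteratedDeriv_one, hd1, hd2,
    hd3, hd4] at h
  simpa using h.symm

lemma integrable_inner_pow {n : ℕ} (w : EuclideanSpace ℝ (Fin n)) (p : ℕ) :
    Integrable (fun a => (inner ℝ a w) ^ p) (stdGaussian (EuclideanSpace ℝ (Fin n))) := by
  have h : Integrable (fun t : ℝ => t ^ p)
      ((stdGaussian (EuclideanSpace ℝ (Fin n))).map (fun a => inner ℝ a w)) := by
    rw [map_inner_stdGaussian, integrable_map_measure (by fun_prop) (by fun_prop)]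
    simpa [Function.comp_def, mul_pow] using (integrable_pow_gaussianReal p).const_mul (‖w‖ ^ p)
  exact (integrable_map_measure (f := fun a => inner ℝ a w) (g := fun t : ℝ => t ^ p)
    (by fun_prop) (by fun_prop)).1 h

lemma integral_inner_pow {n : ℕ} (w : EuclideanSpace ℝ (Fin n)) (p : ℕ) :
    ∫ a, (inner ℝ a w) ^ p ∂stdGaussian (EuclideanSpace ℝ (Fin n)) =
      ‖w‖ ^ p * ∫ t, t ^ p ∂gaussianReal 0 1 := by
  rw [integral_inner_stdGaussian w (f := fun t => t ^ p) (by fun_prop), ← integral_const_mul]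
  simp [mul_pow]

/-- Polarisation of the fourth moment of the Gaussian. -/
lemma integral_inner_sq_mul_inner_sq {n : ℕ} (x w : EuclideanSpace ℝ (Fin n)) :
    Integrable (fun a => (inner ℝ a x) ^ 2 * (inner ℝ a w) ^ 2)
      (stdGaussian (EuclideanSpace ℝ (Fin n))) ∧
    ∫ a, (inner ℝ a x) ^ 2 * (inner ℝ a w) ^ 2 ∂stdGaussian (EuclideanSpace ℝ (Fin n)) =
      ‖x‖ ^ 2 * ‖w‖ ^ 2 + 2 * (inner ℝ x w) ^ 2 := by
  have e : (fun a : EuclideanSpace ℝ (Fin n) => (inner ℝ a x) ^ 2 * (inner ℝ a w) ^ 2) =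
      fun a => (1 / 12 : ℝ) * (((inner ℝ a (x + w)) ^ 4 + (inner ℝ a (x - w)) ^ 4) -
        (2 * (inner ℝ a x) ^ 4 + 2 * (inner ℝ a w) ^ 4)) := by
    ext a
    rw [inner_add_right, inner_sub_right]; ring
  have i1 := integrable_inner_pow (x + w) 4
  have i2 := integrable_inner_pow (x - w) 4
  have i3 := (integrable_inner_pow x 4).const_mul 2
  have i4 := (integrable_inner_pow w 4).const_mul 2
  rw [e]
  refine ⟨((i1.fun_add i2).sub (i3.fun_add i4)).const_mul _, ?_⟩
  have i12 := i1.fun_add i2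
  have i34 := i3.fun_add i4
  rw [integral_const_mul, integral_sub i12 i34, integral_add i1 i2,
    integral_add i3 i4, integral_const_mul, integral_const_mul]
  simp only [integral_inner_pow, integral_pow_four_gaussianReal]
  have h1 : ‖x + w‖ ^ 4 = (‖x‖ ^ 2 + 2 * inner ℝ x w + ‖w‖ ^ 2) ^ 2 := by
    rw [← norm_add_sq_real]; ring
  have h2 : ‖x - w‖ ^ 4 = (‖x‖ ^ 2 - 2 * inner ℝ x w + ‖w‖ ^ 2) ^ 2 := by
    rw [← norm_sub_sq_real]; ring
  rw [h1, h2]; ring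

end GaussianMoments

/-! ### Laplace transforms for the upper and lower tails. -/

section ExponentialMoments

/-- Quadratic growth makes the moment generating function finite near 0, where its derivative is the
mean. Its slope at a small l > 0 is thus below the mean plus δ, and 1 + y ≤ exp y concludes. -/
lemma exists_exp_moment_le {φ : ℝ → ℝ} (hm : Measurable φ) (h0 : ∀ t, 0 ≤ φ t) {K : ℝ}
    (hK : 0 < K) (hφ : ∀ t, φ t ≤ K * t ^ 2) {δ : ℝ} (hδ : 0 < δ) :
    ∃ l > 0, ∫⁻ t, ENNReal.ofReal (Real.exp (l * φ t)) ∂gaussianReal 0 1 ≤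
      ENNReal.ofReal (Real.exp (l * (∫ t, φ t ∂gaussianReal 0 1 + δ))) := by
  obtain ⟨C, hC, hint⟩ := IsGaussian.exists_integrable_exp_sq (gaussianReal 0 1)
  have hmem : ∀ l ≤ C / K, Integrable (fun t => Real.exp (l * φ t)) (gaussianReal 0 1) := by
    intro l hl
    refine hint.mono' (by fun_prop) (Filter.Eventually.of_forall fun t => ?_)
    rw [Real.norm_eq_abs, abs_of_pos (Real.exp_pos _), Real.exp_le_exp, Real.norm_eq_abs, sq_abs]
    calc l * φ t ≤ C / K * φ t := mul_le_mul_of_nonneg_right hl (h0 t)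
      _ ≤ C / K * (K * t ^ 2) := mul_le_mul_of_nonneg_left (hφ t) (by positivity)
      _ = C * t ^ 2 := by field_simp
  have hint0 : (0 : ℝ) ∈ interior (integrableExpSet φ (gaussianReal 0 1)) :=
    mem_interior.2 ⟨Set.Iio (C / K), fun l hl => hmem l (le_of_lt hl), isOpen_Iio, by
      simp; positivity⟩
  have hd := hasDerivAt_mgf hint0
  simp only [zero_mul, Real.exp_zero, mul_one] at hd
  have hlt : ∀ᶠ l in 𝓝[>] (0 : ℝ),
      slope (mgf φ (gaussianReal 0 1)) 0 l < ∫ t, φ t ∂gaussianReal 0 1 + δ :=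
    (hasDerivAt_iff_tendsto_slope.1 hd).mono_left
      (nhdsWithin_mono _ fun y hy => ne_of_gt hy) |>.eventually_lt_const (by linarith)
  have hlt2 : ∀ᶠ l in 𝓝[>] (0 : ℝ), l < C / K :=
    (nhdsWithin_le_nhds (Iio_mem_nhds (by positivity)))
  obtain ⟨l, ⟨hl1, hl2⟩, hl3⟩ := ((hlt.and hlt2).and self_mem_nhdsWithin).exists
  have hl3 : 0 < l := hl3
  refine ⟨l, hl3, ?_⟩
  rw [← ofReal_integral_eq_lintegral_ofReal (hmem l hl2.le)
    (Filter.Eventually.of_forall fun t => (Real.exp_pos _).le)]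
  refine ENNReal.ofReal_le_ofReal ?_
  rw [slope_def_field, mgf_zero, sub_zero, div_lt_iff₀ hl3] at hl1
  have := Real.add_one_le_exp (l * (∫ t, φ t ∂gaussianReal 0 1 + δ))
  unfold mgf at hl1
  linarith

/-- Since exp y ≥ 1 + y + y²/2 and (1 - y + y²/2)(1 + y + y²/2) = 1 + y⁴/4. -/
lemma exp_neg_le_quadratic {y : ℝ} (hy : 0 ≤ y) : Real.exp (-y) ≤ 1 - y + y ^ 2 / 2 := by
  have h : ∀ y : ℝ, 0 ≤ y → (1 - y + y ^ 2 / 2) * Real.exp y ≥ 1 := by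
    intro y hy
    have h1 := Real.quadratic_le_exp_of_nonneg hy
    nlinarith [sq_nonneg (y ^ 2), sq_nonneg (y - 1)]
  have := h y hy
  rw [Real.exp_neg, inv_eq_one_div, div_le_iff₀ (Real.exp_pos y)]
  linarith

/-- Lower tail: for a nonnegative variable the second moment controls the Laplace transform. -/
lemma lintegral_exp_neg_le {Ω : Type*} [MeasurableSpace Ω] {μ : Measure Ω}
    [IsProbabilityMeasure μ] {Y : Ω → ℝ} (h0 : ∀ a, 0 ≤ Y a) (hi : Integrable Y μ)
    (hi2 : Integrable (fun a => Y a ^ 2) μ) {q V l : ℝ} (hq : q ≤ ∫ a, Y a ∂μ)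
    (hV : ∫ a, Y a ^ 2 ∂μ ≤ V) (hl : 0 ≤ l) :
    ∫⁻ a, ENNReal.ofReal (Real.exp (-(l * Y a))) ∂μ ≤
      ENNReal.ofReal (Real.exp (l * (-q + l * V / 2))) := by
  have hint : Integrable (fun a => 1 - l * Y a + l ^ 2 / 2 * Y a ^ 2) μ :=
    ((integrable_const _).sub (hi.const_mul l)).add (hi2.const_mul _)
  calc ∫⁻ a, ENNReal.ofReal (Real.exp (-(l * Y a))) ∂μ
      ≤ ∫⁻ a, ENNReal.ofReal (1 - l * Y a + l ^ 2 / 2 * Y a ^ 2) ∂μ := by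
        refine lintegral_mono fun a => ENNReal.ofReal_le_ofReal ?_
        have := exp_neg_le_quadratic (mul_nonneg hl (h0 a))
        nlinarith
    _ = ENNReal.ofReal (∫ a, (1 - l * Y a + l ^ 2 / 2 * Y a ^ 2) ∂μ) := by
        rw [ofReal_integral_eq_lintegral_ofReal hint]
        refine Filter.Eventually.of_forall fun a => ?_
        simp only [Pi.zero_apply]
        nlinarith [sq_nonneg (l * Y a - 1)]
    _ ≤ _ := by
        refine ENNReal.ofReal_le_ofReal ?_
        have hint1 : Integrable (fun a => 1 - l * Y a) μ := (integrable_const _).sub (hi.const_mul l)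
        rw [integral_add hint1 (hi2.const_mul _),
          integral_sub (integrable_const _) (hi.const_mul l), integral_const_mul,
          integral_const_mul]
        simp only [integral_const, probReal_univ, one_smul]
        have h1 := Real.add_one_le_exp (l * (-q + l * V / 2))
        have h2 := mul_le_mul_of_nonneg_left hq hl
        have h3 := mul_le_mul_of_nonneg_left hV (show 0 ≤ l ^ 2 / 2 by positivity)
        nlinarith

end ExponentialMoments

/-! ### Uniform deviation bounds by averaging over balls. -/

section Averaging

variable {n m : ℕ}

/-- Both w ↦ v + w and w ↦ v - w preserve volume and carry the centred ball onto the ball around v.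
-/
lemma volume_closedBall_mul_le {Ψ : EuclideanSpace ℝ (Fin n) → ENNReal} (hΨ : Measurable Ψ)
    {v : EuclideanSpace ℝ (Fin n)} {ρ : ℝ} {c : ENNReal}
    (hc : ∀ w ∈ Metric.closedBall (0 : EuclideanSpace ℝ (Fin n)) ρ,
      2 * c ≤ Ψ (v + w) + Ψ (v - w)) :
    volume (Metric.closedBall (0 : EuclideanSpace ℝ (Fin n)) ρ) * c ≤
      ∫⁻ w in Metric.closedBall v ρ, Ψ w := by
  set χ := (Metric.closedBall v ρ).indicator Ψ with hχ
  have hχm : Measurable χ := hΨ.indicator Metric.isClosed_closedBall.measurableSet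
  have e1 : ∫⁻ w, χ (v + w) = ∫⁻ w in Metric.closedBall v ρ, Ψ w := by
    rw [lintegral_add_left_eq_self χ v,
      lintegral_indicator Metric.isClosed_closedBall.measurableSet]
  have e2 : ∫⁻ w, χ (v - w) = ∫⁻ w in Metric.closedBall v ρ, Ψ w := by
    rw [lintegral_sub_left_eq_self χ v,
      lintegral_indicator Metric.isClosed_closedBall.measurableSet]
  have h2 : 2 * (volume (Metric.closedBall (0 : EuclideanSpace ℝ (Fin n)) ρ) * c) ≤
      2 * ∫⁻ w in Metric.closedBall v ρ, Ψ w := by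
    calc 2 * (volume (Metric.closedBall (0 : EuclideanSpace ℝ (Fin n)) ρ) * c)
        = ∫⁻ w in Metric.closedBall (0 : EuclideanSpace ℝ (Fin n)) ρ, 2 * c := by
          rw [setLIntegral_const]; ring
      _ = ∫⁻ w, (Metric.closedBall (0 : EuclideanSpace ℝ (Fin n)) ρ).indicator
            (fun _ => 2 * c) w := by
          rw [lintegral_indicator Metric.isClosed_closedBall.measurableSet]
      _ ≤ ∫⁻ w, χ (v + w) + χ (v - w) := by
          refine lintegral_mono fun w => ?_
          by_cases hw : w ∈ Metric.closedBall (0 : EuclideanSpace ℝ (Fin n)) ρ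
          · have hw' : ‖w‖ ≤ ρ := by simpa using hw
            have m1 : v + w ∈ Metric.closedBall v ρ := by simpa [dist_eq_norm] using hw'
            have m2 : v - w ∈ Metric.closedBall v ρ := by simpa [dist_eq_norm] using hw'
            rw [Set.indicator_of_mem hw, hχ, Set.indicator_of_mem m1, Set.indicator_of_mem m2]
            exact hc w hw
          · rw [Set.indicator_of_notMem hw]; exact zero_le
      _ = 2 * ∫⁻ w in Metric.closedBall v ρ, Ψ w := by
          rw [lintegral_add_left (by fun_prop), e1, e2]; ring
  exact (ENNReal.mul_le_mul_iff_right (by norm_num) (by norm_num)).1 h2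

/-- A uniform deviation bound obtained by averaging over a ball instead of discretising it. -/
theorem exists_uniform_exp_bound (m : ℕ)
    {ψ : EuclideanSpace ℝ (Fin n) → EuclideanSpace ℝ (Fin n) → ℝ}
    (hψ : Measurable (Function.uncurry ψ)) {S : Set (EuclideanSpace ℝ (Fin n))}
    (hS : MeasurableSet S) {R θ δ : ℝ} (hR : 0 < R) (hSR : S ⊆ Metric.closedBall 0 R)
    (hθ : ∀ w ∈ S, ∫⁻ a, ENNReal.ofReal (Real.exp (ψ a w))
      ∂stdGaussian (EuclideanSpace ℝ (Fin n)) ≤ ENNReal.ofReal (Real.exp θ)) :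
    ∃ B : Set (Fin m → EuclideanSpace ℝ (Fin n)), MeasurableSet B ∧
      (Measure.pi fun _ : Fin m => stdGaussian (EuclideanSpace ℝ (Fin n))) Bᶜ ≤
        ENNReal.ofReal (Real.exp (-(m * δ))) ∧
      ∀ a ∈ B, ∀ (v : EuclideanSpace ℝ (Fin n)) (ρ b : ℝ), 0 < ρ → Metric.closedBall v ρ ⊆ S →
        (∀ w ∈ Metric.closedBall (0 : EuclideanSpace ℝ (Fin n)) ρ,
          2 * Real.exp b ≤ Real.exp (∑ k, ψ (a k) (v + w)) + Real.exp (∑ k, ψ (a k) (v - w))) →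
        b ≤ m * (θ + δ) + n * Real.log (R / ρ) := by
  set P := (Measure.pi fun _ : Fin m => stdGaussian (EuclideanSpace ℝ (Fin n))) with hP
  set f : EuclideanSpace ℝ (Fin n) → EuclideanSpace ℝ (Fin n) → ENNReal :=
    fun w a => ENNReal.ofReal (Real.exp (ψ a w)) with hf
  have hfm : Measurable (Function.uncurry f) := by
    have : Measurable fun p : EuclideanSpace ℝ (Fin n) × EuclideanSpace ℝ (Fin n) =>
      Function.uncurry ψ (p.2, p.1) := hψ.comp measurable_swap
    exact (this.exp).ennreal_ofReal
  set Ψ : (Fin m → EuclideanSpace ℝ (Fin n)) → EuclideanSpace ℝ (Fin n) → ENNReal :=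
    fun a w => ∏ k, f w (a k) with hΨ
  have hΨm : Measurable (Function.uncurry Ψ) := by
    refine Finset.measurable_prod _ fun k _ => ?_
    exact hfm.comp (measurable_snd.prodMk ((measurable_pi_apply k).comp measurable_fst))
  have hΨe : ∀ a w, Ψ a w = ENNReal.ofReal (Real.exp (∑ k, ψ (a k) w)) := by
    intro a w
    simp only [hΨ, hf]
    rw [Real.exp_sum, ENNReal.ofReal_prod_of_nonneg fun _ _ => (Real.exp_pos _).le]
  set Z : (Fin m → EuclideanSpace ℝ (Fin n)) → ENNReal := fun a => ∫⁻ w in S, Ψ a w with hZ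
  have hZm : Measurable Z := hΨm.lintegral_prod_right'
  set V := volume (Metric.closedBall (0 : EuclideanSpace ℝ (Fin n)) R) with hV
  have hV0 : V ≠ 0 := (Metric.measure_closedBall_pos _ _ hR).ne'
  have hVt : V ≠ ⊤ := measure_closedBall_lt_top.ne
  have hprod : ∀ w ∈ S, ∫⁻ a, Ψ a w ∂P ≤ ENNReal.ofReal (Real.exp (m * θ)) := by
    intro w hw
    have hind := iIndepFun_pi (μ := fun _ : Fin m => stdGaussian (EuclideanSpace ℝ (Fin n)))
      (X := fun _ => f w) (fun _ => (hfm.of_uncurry_left).aemeasurable)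
    have hmk : ∀ k : Fin m, Measurable fun a : Fin m → EuclideanSpace ℝ (Fin n) => f w (a k) :=
      fun k => hfm.of_uncurry_left.comp (measurable_pi_apply k)
    simp only [hΨ]
    rw [lintegral_prod_eq_prod_lintegral_of_indepFun Finset.univ
      (fun k (a : Fin m → EuclideanSpace ℝ (Fin n)) => f w (a k)) hind hmk]
    have hk : ∀ k : Fin m, ∫⁻ a, f w (a k) ∂P ≤ ENNReal.ofReal (Real.exp θ) := by
      intro k
      have := (measurePreserving_eval
        (fun _ : Fin m => stdGaussian (EuclideanSpace ℝ (Fin n))) k).lintegral_comp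
          hfm.of_uncurry_left (f := f w)
      rw [← hP] at this
      simp only [Function.eval] at this
      rw [this]
      exact hθ w hw
    calc _ ≤ ∏ _k : Fin m, ENNReal.ofReal (Real.exp θ) := Finset.prod_le_prod' fun k _ => hk k
      _ = _ := by
        rw [Finset.prod_const, Finset.card_univ, Fintype.card_fin, ← ENNReal.ofReal_pow
          (Real.exp_pos _).le, ← Real.exp_nat_mul]
  have hEZ : ∫⁻ a, Z a ∂P ≤ V * ENNReal.ofReal (Real.exp (m * θ)) := by
    simp only [hZ]
    rw [lintegral_lintegral_swap hΨm.aemeasurable]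
    calc _ ≤ ∫⁻ w in S, ENNReal.ofReal (Real.exp (m * θ)) :=
          setLIntegral_mono' hS fun w hw => hprod w hw
      _ = ENNReal.ofReal (Real.exp (m * θ)) * volume S := setLIntegral_const _ _
      _ ≤ _ := by rw [mul_comm]; exact mul_le_mul_left (measure_mono hSR) _
  -- The Markov threshold: exp(mδ) times the bound on the mean of `Z`.
  set T := V * ENNReal.ofReal (Real.exp (m * (θ + δ))) with hT
  have hT0 : T ≠ 0 := mul_ne_zero hV0 (by simp [Real.exp_pos])
  have hTt : T ≠ ⊤ := ENNReal.mul_ne_top hVt ENNReal.ofReal_ne_top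
  refine ⟨{a | Z a ≤ T}, measurableSet_le hZm measurable_const, ?_, ?_⟩
  · calc P {a | Z a ≤ T}ᶜ ≤ P {a | T ≤ Z a} := by
          refine measure_mono fun a ha => ?_
          simp only [Set.mem_compl_iff, Set.mem_ofPred_eq, not_le] at ha ⊢
          exact ha.le
      _ ≤ (∫⁻ a, Z a ∂P) / T := meas_ge_le_lintegral_div hZm.aemeasurable hT0 hTt
      _ ≤ (V * ENNReal.ofReal (Real.exp (m * θ))) / T := by gcongr
      _ ≤ ENNReal.ofReal (Real.exp (-(m * δ))) := by
          rw [ENNReal.div_le_iff hT0 hTt, hT, mul_left_comm, ← ENNReal.ofReal_mul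
            (Real.exp_pos _).le, ← Real.exp_add]
          gcongr
          exact le_of_eq (by ring)
  · intro a ha v ρ b hρ hvS hb
    have h1 := volume_closedBall_mul_le (Ψ := Ψ a) hΨm.of_uncurry_left (v := v) (ρ := ρ)
      (c := ENNReal.ofReal (Real.exp b)) (by
        intro w hw
        rw [hΨe, hΨe, ← ENNReal.ofReal_add (Real.exp_pos _).le (Real.exp_pos _).le]
        calc 2 * ENNReal.ofReal (Real.exp b) = ENNReal.ofReal (2 * Real.exp b) := by
              rw [ENNReal.ofReal_mul (by norm_num)]; simp
          _ ≤ _ := ENNReal.ofReal_le_ofReal (hb w hw))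
    have h2 : volume (Metric.closedBall (0 : EuclideanSpace ℝ (Fin n)) ρ) *
        ENNReal.ofReal (Real.exp b) ≤ T :=
      h1.trans ((lintegral_mono_set hvS).trans ha)
    -- The volume of the unit ball cancels; the ratio (R/ρ)ⁿ becomes n log(R/ρ).
    rw [hT, hV, Measure.addHaar_closedBall _ _ hρ.le, Measure.addHaar_closedBall _ _ hR.le,
      mul_right_comm, mul_right_comm (ENNReal.ofReal (R ^ _))] at h2
    have h3 := (ENNReal.mul_le_mul_iff_left (Metric.measure_ball_pos _ _ one_pos).ne'
      measure_ball_lt_top.ne).1 h2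
    rw [← ENNReal.ofReal_mul (by positivity), ← ENNReal.ofReal_mul (by positivity),
      ENNReal.ofReal_le_ofReal_iff (by positivity), finrank_euclideanSpace_fin] at h3
    have h4 := Real.log_le_log (by positivity) h3
    rw [Real.log_mul (by positivity) (Real.exp_pos _).ne', Real.log_mul (by positivity)
      (Real.exp_pos _).ne', Real.log_exp, Real.log_exp, Real.log_pow, Real.log_pow] at h4
    rw [Real.log_div hR.ne' hρ.ne']
    linarith

end Averaging

/-! ### Uniform upper and lower bounds for empirical sums. -/

section Uniform

/-- Midpoint convexity of exp, which lifts a midpoint inequality for exponents to the form needed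
for averaging. -/
lemma two_mul_exp_le {b s t : ℝ} (h : 2 * b ≤ s + t) : 2 * Real.exp b ≤ Real.exp s + Real.exp t := by
  have h1 : Real.exp b ≤ Real.exp (s / 2) * Real.exp (t / 2) := by
    rw [← Real.exp_add]; exact Real.exp_le_exp.2 (by linarith)
  have h2 : Real.exp s = Real.exp (s / 2) ^ 2 := by rw [← Real.exp_nat_mul]; congr 1; push_cast; ring
  have h3 : Real.exp t = Real.exp (t / 2) ^ 2 := by rw [← Real.exp_nat_mul]; congr 1; push_cast; ring
  rw [h2, h3]
  nlinarith [sq_nonneg (Real.exp (s / 2) - Real.exp (t / 2))]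

/-- Uniform upper deviations over the unit ball of sums of convex functions of Gaussian
projections. -/
theorem exists_uniform_upper {φ : ℝ → ℝ} (hc : ConvexOn ℝ Set.univ φ) (hm : Measurable φ)
    (h0 : ∀ t, 0 ≤ φ t) (hmono : ∀ s t, |s| ≤ |t| → φ s ≤ φ t) {K : ℝ} (hK : 0 < K)
    (hφ : ∀ t, φ t ≤ K * t ^ 2) {r δ : ℝ} (hr : 1 < r) (hδ : 0 < δ) :
    ∃ C c : ℝ, 0 < C ∧ 0 < c ∧ ∀ n m : ℕ, C * n ≤ m →
      ∃ B : Set (Fin m → EuclideanSpace ℝ (Fin n)), MeasurableSet B ∧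
        (Measure.pi fun _ : Fin m => stdGaussian (EuclideanSpace ℝ (Fin n))) Bᶜ ≤
          ENNReal.ofReal (Real.exp (-(c * m))) ∧
        ∀ a ∈ B, ∀ v : EuclideanSpace ℝ (Fin n), ‖v‖ ≤ 1 →
          ∑ k, φ (inner ℝ (a k) v) ≤ m * (∫ t, φ (r * t) ∂gaussianReal 0 1 + δ) := by
  have hr0 : 0 < r := by linarith
  -- Monotonicity in |t| lets the radius r serve for every w in the ball.
  obtain ⟨l, hl, hexp⟩ := exists_exp_moment_le (φ := fun t => φ (r * t)) (by fun_prop)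
    (fun t => h0 _) (K := K * r ^ 2) (by positivity)
    (fun t => (hφ _).trans (le_of_eq (by ring))) (δ := δ / 3) (by positivity)
  set I := ∫ t, φ (r * t) ∂gaussianReal 0 1 with hI
  have hlog : 0 < Real.log (r / (r - 1)) :=
    Real.log_pos (by rw [lt_div_iff₀ (by linarith)]; linarith)
  -- The slack δ is split in thirds among the exponential moment, Markov's inequality and the volume
  -- term n log(r/(r - 1)).
  refine ⟨3 * Real.log (r / (r - 1)) / (l * δ), l * δ / 3, by positivity, by positivity, ?_⟩
  intro n m hnm
  obtain ⟨B, hBm, hBP, hB⟩ := exists_uniform_exp_bound (n := n) m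
    (ψ := fun a w => l * φ (inner ℝ a w)) (S := Metric.closedBall 0 r) (R := r)
    (θ := l * (I + δ / 3)) (δ := l * δ / 3)
    (by
      have : Measurable fun p : EuclideanSpace ℝ (Fin n) × EuclideanSpace ℝ (Fin n) =>
        l * φ (inner ℝ p.1 p.2) := by fun_prop
      exact this)
    Metric.isClosed_closedBall.measurableSet hr0 le_rfl (by
      intro w hw
      rw [lintegral_inner_stdGaussian w (f := fun t => ENNReal.ofReal (Real.exp (l * φ t)))
        (by fun_prop)]
      refine le_trans (lintegral_mono fun t => ENNReal.ofReal_le_ofReal ?_) hexp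
      refine Real.exp_le_exp.2 (mul_le_mul_of_nonneg_left (hmono _ _ ?_) hl.le)
      rw [abs_mul, abs_mul, abs_of_pos hr0, abs_of_nonneg (norm_nonneg w)]
      exact mul_le_mul_of_nonneg_right (by simpa using hw) (abs_nonneg t))
  refine ⟨B, hBm, hBP.trans (le_of_eq (by ring_nf)), fun a ha v hv => ?_⟩
  have key := hB a ha v (r - 1) (l * ∑ k, φ (inner ℝ (a k) v)) (by linarith)
    (Metric.closedBall_subset_closedBall' (by simp; linarith)) (by
      intro w _
      refine two_mul_exp_le ?_
      rw [← Finset.mul_sum, ← Finset.mul_sum, ← mul_add, ← Finset.sum_add_distrib, mul_left_comm,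
        Finset.mul_sum]
      refine mul_le_mul_of_nonneg_left (Finset.sum_le_sum fun k _ => ?_) hl.le
      have := hc.2 (Set.mem_univ (inner ℝ (a k) (v + w))) (Set.mem_univ (inner ℝ (a k) (v - w)))
        (show (0 : ℝ) ≤ 1 / 2 by norm_num) (show (0 : ℝ) ≤ 1 / 2 by norm_num) (by norm_num)
      simp only [smul_eq_mul, inner_add_right, inner_sub_right] at this ⊢
      rw [show (1 / 2 * (inner ℝ (a k) v + inner ℝ (a k) w) +
        1 / 2 * (inner ℝ (a k) v - inner ℝ (a k) w) : ℝ) = inner ℝ (a k) v by ring] at this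
      linarith)
  rw [div_mul_eq_mul_div, div_le_iff₀ (by positivity)] at hnm
  refine le_of_mul_le_mul_left ?_ hl
  nlinarith

/-- Uniform lower bound over the unit sphere for the quadratic form with weights
`min ⟨aₖ, x⟩² τ`. -/
theorem exists_uniform_lower {τ K : ℝ} (hτ : 0 < τ) (hK : 0 < K)
    (hτ6 : 65 * ∫ t, t ^ 6 ∂gaussianReal 0 1 ≤ τ / 100) :
    ∃ C c : ℝ, 0 < C ∧ 0 < c ∧ ∀ n m : ℕ, C * n ≤ m →
      ∀ x : EuclideanSpace ℝ (Fin n), ‖x‖ = 1 →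
      ∃ B : Set (Fin m → EuclideanSpace ℝ (Fin n)), MeasurableSet B ∧
        (Measure.pi fun _ : Fin m => stdGaussian (EuclideanSpace ℝ (Fin n))) Bᶜ ≤
          ENNReal.ofReal (Real.exp (-(c * m))) ∧
        ∀ a ∈ B, (∀ w : EuclideanSpace ℝ (Fin n), ‖w‖ ≤ 1 → ∑ k, (inner ℝ (a k) w) ^ 2 ≤ K * m) →
          ∀ v : EuclideanSpace ℝ (Fin n), ‖v‖ = 1 →
          95 / 100 * m ≤ ∑ k, min ((inner ℝ (a k) x) ^ 2) τ * (inner ℝ (a k) v) ^ 2 := by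
  -- η is the averaging radius: (1 - η)² ≥ 99/100, and the form is at most m/100 on vectors of norm
  -- at most η.
  obtain ⟨η, hη0, hη1, hηK⟩ : ∃ η : ℝ, 0 < η ∧ η ≤ 1 / 200 ∧ τ * K * η ^ 2 ≤ 1 / 100 := by
    refine ⟨min (1 / 200) (1 / (100 * τ * K)), by positivity, min_le_left _ _, ?_⟩
    set η := min (1 / 200) (1 / (100 * τ * K)) with hη
    have h0 : 0 ≤ η := by positivity
    have h1 : η ≤ 1 := (min_le_left _ _).trans (by norm_num)
    have h2 : η * (100 * τ * K) ≤ 1 := by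
      have := min_le_right (1 / 200) (1 / (100 * τ * K))
      rwa [← hη, le_div_iff₀ (by positivity)] at this
    nlinarith [mul_pos hτ hK, mul_nonneg h0 (mul_pos hτ hK).le]
  -- On the annulus the second moment is at most 3 · 2⁴ τ² = 48τ², and this l makes l · 48τ² =
  -- 1/100.
  set l : ℝ := 1 / (4800 * τ ^ 2) with hl
  have hl0 : 0 < l := by positivity
  have hlog : 0 < Real.log (2 / η) := Real.log_pos (by rw [lt_div_iff₀ hη0]; linarith)
  refine ⟨200 * Real.log (2 / η) / l, l / 200, by positivity, by positivity, ?_⟩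
  intro n m hnm x hx
  set S : Set (EuclideanSpace ℝ (Fin n)) := {w | 1 - η ≤ ‖w‖ ∧ ‖w‖ ≤ 2} with hS
  have hSm : MeasurableSet S :=
    (measurableSet_le measurable_const measurable_norm).inter
      (measurableSet_le measurable_norm measurable_const)
  set A := ∫ t, t ^ 6 ∂gaussianReal 0 1 with hA
  have hA0 : 0 ≤ A := integral_nonneg fun t => by positivity
  obtain ⟨B, hBm, hBP, hB⟩ := exists_uniform_exp_bound (n := n) m
    (ψ := fun a w => -(l * (min ((inner ℝ a x) ^ 2) τ * (inner ℝ a w) ^ 2))) (S := S) (R := 2)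
    (θ := l * (-(98 / 100) + l * (48 * τ ^ 2) / 2)) (δ := l / 200)
    (by
      have : Measurable fun p : EuclideanSpace ℝ (Fin n) × EuclideanSpace ℝ (Fin n) =>
        -(l * (min ((inner ℝ p.1 x) ^ 2) τ * (inner ℝ p.1 p.2) ^ 2)) := by fun_prop
      exact this)
    hSm two_pos (fun w hw => by simpa using hw.2) (by
      intro w hw
      have hmeas : Measurable fun a : EuclideanSpace ℝ (Fin n) =>
        min ((inner ℝ a x) ^ 2) τ * (inner ℝ a w) ^ 2 := by fun_prop
      have hmin0 : ∀ a : EuclideanSpace ℝ (Fin n), 0 ≤ min ((inner ℝ a x) ^ 2) τ :=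
        fun a => le_min (sq_nonneg _) hτ.le
      have hi4 := integrable_inner_pow w 4
      have hi2 := integrable_inner_pow w 2
      have hi : Integrable (fun a : EuclideanSpace ℝ (Fin n) =>
          min ((inner ℝ a x) ^ 2) τ * (inner ℝ a w) ^ 2) (stdGaussian _) := by
        refine (hi2.const_mul τ).mono' hmeas.aestronglyMeasurable
          (Filter.Eventually.of_forall fun a => ?_)
        rw [Real.norm_eq_abs, abs_of_nonneg (mul_nonneg (hmin0 a) (sq_nonneg _))]
        exact mul_le_mul_of_nonneg_right (min_le_right _ _) (sq_nonneg _)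
      have hsq : ∀ a : EuclideanSpace ℝ (Fin n),
          (min ((inner ℝ a x) ^ 2) τ * (inner ℝ a w) ^ 2) ^ 2 ≤ τ ^ 2 * (inner ℝ a w) ^ 4 := by
        intro a
        rw [mul_pow, ← pow_mul]
        exact mul_le_mul_of_nonneg_right (pow_le_pow_left₀ (hmin0 a) (min_le_right _ _) 2)
          (Even.pow_nonneg (by decide) _)
      have hisq : Integrable (fun a : EuclideanSpace ℝ (Fin n) =>
          (min ((inner ℝ a x) ^ 2) τ * (inner ℝ a w) ^ 2) ^ 2) (stdGaussian _) := by
        refine (hi4.const_mul (τ ^ 2)).mono' (hmeas.pow_const 2).aestronglyMeasurable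
          (Filter.Eventually.of_forall fun a => ?_)
        rw [Real.norm_eq_abs, abs_of_nonneg (sq_nonneg _)]
        exact hsq a
      have hw0 := norm_nonneg w
      refine lintegral_exp_neg_le (fun a => mul_nonneg (hmin0 a) (sq_nonneg _)) hi hisq ?_ ?_ hl0.le
      · obtain ⟨j1, j2⟩ := integral_inner_sq_mul_inner_sq x w
        have j3 := integrable_inner_pow x 6
        have j4 := integrable_inner_pow w 6
        have j5 := (j3.fun_add j4).const_mul (1 / τ)
        have hle : ∫ a : EuclideanSpace ℝ (Fin n), ((inner ℝ a x) ^ 2 * (inner ℝ a w) ^ 2 -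
            1 / τ * ((inner ℝ a x) ^ 6 + (inner ℝ a w) ^ 6)) ∂stdGaussian _ ≤
            ∫ a : EuclideanSpace ℝ (Fin n), min ((inner ℝ a x) ^ 2) τ * (inner ℝ a w) ^ 2
              ∂stdGaussian _ := by
          refine integral_mono (j1.sub j5) hi fun a => ?_
          simp only
          set s := (inner ℝ a x) ^ 2 with hs
          set t := (inner ℝ a w) ^ 2 with ht
          have hs0 : 0 ≤ s := sq_nonneg _
          have ht0 : 0 ≤ t := sq_nonneg _
          have e1 : (inner ℝ a x) ^ 6 = s ^ 3 := by rw [hs]; ring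
          have e2 : (inner ℝ a w) ^ 6 = t ^ 3 := by rw [ht]; ring
          rw [e1, e2]
          -- With min(s, τ) ≥ s - s²/τ, truncation costs only sixth moments over τ; since ‖x‖ = 1
          -- and ‖w‖ ≤ 2 these carry the factor 1 + 2⁶ = 65.
          have h3 : s ^ 2 * t ≤ s ^ 3 + t ^ 3 := by
            rcases le_total s t with h | h
            · have := pow_le_pow_left₀ hs0 h 2
              nlinarith [mul_le_mul_of_nonneg_right this ht0, pow_nonneg hs0 3]
            · nlinarith [mul_le_mul_of_nonneg_left h (sq_nonneg s), pow_nonneg ht0 3]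
          have h4 : s - 1 / τ * s ^ 2 ≤ min s τ := by
            refine le_min (sub_le_self _ (by positivity)) ?_
            rw [sub_le_iff_le_add, ← sub_nonneg]
            have : τ + 1 / τ * s ^ 2 - s = ((s - τ / 2) ^ 2 + 3 / 4 * τ ^ 2) / τ := by
              field_simp; ring
            rw [this]; positivity
          have h5 := mul_le_mul_of_nonneg_right h4 ht0
          have h6 := mul_le_mul_of_nonneg_left h3 (show 0 ≤ 1 / τ by positivity)
          nlinarith
        rw [integral_sub j1 j5, j2, integral_const_mul, integral_add j3 j4, integral_inner_pow,
          integral_inner_pow, hx, ← hA] at hle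
        refine le_trans ?_ hle
        have h1 : (1 - η) ^ 2 ≤ ‖w‖ ^ 2 := pow_le_pow_left₀ (by linarith) hw.1 2
        have h2 : ‖w‖ ^ 6 ≤ 64 := (pow_le_pow_left₀ hw0 hw.2 6).trans (by norm_num)
        have h3 : 1 / τ * (1 ^ 6 * A + ‖w‖ ^ 6 * A) ≤ 1 / 100 := by
          rw [div_mul_eq_mul_div, div_le_iff₀ hτ]
          nlinarith
        nlinarith [sq_nonneg (inner ℝ x w : ℝ)]
      · calc _ ≤ ∫ a : EuclideanSpace ℝ (Fin n), τ ^ 2 * (inner ℝ a w) ^ 4 ∂stdGaussian _ :=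
              integral_mono hisq (hi4.const_mul _) hsq
          _ = τ ^ 2 * (‖w‖ ^ 4 * 3) := by
              rw [integral_const_mul, integral_inner_pow, integral_pow_four_gaussianReal]
          _ ≤ _ := by
              have : ‖w‖ ^ 4 ≤ 16 := (pow_le_pow_left₀ hw0 hw.2 4).trans (by norm_num)
              nlinarith [sq_nonneg τ])
  refine ⟨B, hBm, hBP.trans (le_of_eq (by ring_nf)), fun a ha hKw v hv => ?_⟩
  set Q : EuclideanSpace ℝ (Fin n) → ℝ :=
    fun v => ∑ k, min ((inner ℝ (a k) x) ^ 2) τ * (inner ℝ (a k) v) ^ 2 with hQ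
  have hQpar : ∀ w, Q (v + w) + Q (v - w) = 2 * Q v + 2 * Q w := by
    intro w
    simp only [hQ, Finset.mul_sum, ← Finset.sum_add_distrib]
    refine Finset.sum_congr rfl fun k _ => ?_
    rw [inner_add_right, inner_sub_right]; ring
  have hQsmall : ∀ w : EuclideanSpace ℝ (Fin n), ‖w‖ ≤ η → Q w ≤ m / 100 := by
    intro w hw
    have h1 := hKw (η⁻¹ • w) (by
      rw [norm_smul, norm_inv, Real.norm_eq_abs, abs_of_pos hη0, inv_mul_le_iff₀ hη0]; linarith)
    have h2 : ∑ k, (inner ℝ (a k) w) ^ 2 ≤ η ^ 2 * (K * m) := by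
      simp only [real_inner_smul_right, mul_pow, ← Finset.mul_sum] at h1
      rwa [inv_pow, inv_mul_le_iff₀ (by positivity)] at h1
    calc Q w ≤ ∑ k, τ * (inner ℝ (a k) w) ^ 2 := Finset.sum_le_sum fun k _ =>
          mul_le_mul_of_nonneg_right (min_le_right _ _) (sq_nonneg _)
      _ = τ * ∑ k, (inner ℝ (a k) w) ^ 2 := by rw [Finset.mul_sum]
      _ ≤ τ * (η ^ 2 * (K * m)) := mul_le_mul_of_nonneg_left h2 hτ.le
      _ = (τ * K * η ^ 2) * m := by ring
      _ ≤ 1 / 100 * m := mul_le_mul_of_nonneg_right hηK (Nat.cast_nonneg m)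
      _ = m / 100 := by ring
  have hsum : ∀ w, ∑ k, -(l * (min ((inner ℝ (a k) x) ^ 2) τ * (inner ℝ (a k) w) ^ 2)) =
      -(l * Q w) := by
    intro w; simp only [hQ, Finset.mul_sum, Finset.sum_neg_distrib]
  have key := hB a ha v η (-(l * (Q v + m / 100))) hη0 (by
      intro w hw
      rw [Metric.mem_closedBall, dist_eq_norm] at hw
      have h1 := norm_sub_norm_le v w
      have h2 := norm_sub_norm_le w v
      rw [norm_sub_rev] at h1
      exact ⟨by linarith, by linarith⟩) (by
      intro w hw
      refine two_mul_exp_le ?_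
      rw [hsum, hsum]
      -- The exponent -l Q is concave, so convexity is unavailable; the parallelogram law leaves
      -- only the error Q w ≤ m/100.
      have h1 := hQpar w
      have h2 := hQsmall w (by simpa using hw)
      nlinarith)
  rw [div_mul_eq_mul_div, div_le_iff₀ hl0] at hnm
  have hl2 : l * (48 * τ ^ 2) = 1 / 100 := by rw [hl]; field_simp; norm_num
  rw [hl2] at key
  change 95 / 100 * (m : ℝ) ≤ Q v
  have : 0 ≤ l * m := by positivity
  refine le_of_mul_le_mul_left ?_ hl0
  nlinarith

end Uniform

/-! ### Convex test functions of quadratic growth. -/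

section TestFunctions

/-- The squared distance to the interval `[-σ, σ]`. -/
noncomputable def tailSq (σ t : ℝ) : ℝ := (max (|t| - σ) 0) ^ 2

/-- The Huber function, quadratic on `[-T, T]` and affine on either side. -/
noncomputable def huber (T t : ℝ) : ℝ := t ^ 2 - tailSq T t

variable {σ T : ℝ}

lemma tailSq_nonneg (t : ℝ) : 0 ≤ tailSq σ t := sq_nonneg _

lemma tailSq_mono {s t : ℝ} (h : |s| ≤ |t|) : tailSq σ s ≤ tailSq σ t :=
  pow_le_pow_left₀ (le_max_right _ _) (max_le_max (by linarith) le_rfl) 2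

lemma tailSq_le_sq (hσ : 0 ≤ σ) (t : ℝ) : tailSq σ t ≤ t ^ 2 := by
  rw [← sq_abs t]
  exact pow_le_pow_left₀ (le_max_right _ _) (max_le (by linarith) (abs_nonneg t)) 2

lemma measurable_tailSq : Measurable (tailSq σ) := by
  unfold tailSq; fun_prop

lemma convexOn_tailSq : ConvexOn ℝ Set.univ (tailSq σ) := by
  have h1 : ConvexOn ℝ Set.univ fun t : ℝ => |t| - σ := by
    have h0 : ConvexOn ℝ Set.univ fun t : ℝ => ‖t‖ := convexOn_univ_norm
    simpa [sub_eq_add_neg, Pi.add_def] using h0.add_const (-σ)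
  have h2 : ConvexOn ℝ Set.univ fun t : ℝ => max (|t| - σ) 0 :=
    h1.sup (convexOn_const 0 convex_univ)
  exact h2.pow (fun t _ => le_max_right _ _) 2

/-- The left side vanishes unless 2|t| > σ, where (2|t|/σ)²⁴ ≥ 1. The power 24 beats the later error
coefficients of order σ²⁰. -/
lemma tailSq_two_mul_le (hσ : 0 < σ) (t : ℝ) : tailSq σ (2 * t) ≤ 2 ^ 26 / σ ^ 24 * t ^ 26 := by
  unfold tailSq
  rw [abs_mul, abs_two]
  rcases le_or_gt (2 * |t|) σ with h | h
  · rw [max_eq_right (by linarith)]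
    have : 0 ≤ t ^ 26 := Even.pow_nonneg (by decide) t
    have : 0 ≤ 2 ^ 26 / σ ^ 24 * t ^ 26 := by positivity
    simpa using this
  · rw [max_eq_left (by linarith)]
    have h1 : (2 * |t| - σ) ^ 2 ≤ (2 * |t|) ^ 2 :=
      pow_le_pow_left₀ (by linarith) (by linarith) 2
    have h2 : σ ^ 24 ≤ (2 * |t|) ^ 24 := pow_le_pow_left₀ hσ.le h.le 24
    have h3 : t ^ 26 = |t| ^ 26 := ((by decide : Even 26).pow_abs t).symm
    rw [h3, div_mul_eq_mul_div, le_div_iff₀ (by positivity)]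
    calc (2 * |t| - σ) ^ 2 * σ ^ 24 ≤ (2 * |t|) ^ 2 * (2 * |t|) ^ 24 := by gcongr
      _ = 2 ^ 26 * |t| ^ 26 := by ring

lemma integral_tailSq_le (hσ : 0 < σ) :
    ∫ t, tailSq σ (2 * t) ∂gaussianReal 0 1 ≤
      2 ^ 26 * (∫ t, t ^ 26 ∂gaussianReal 0 1) / σ ^ 24 := by
  have hi := (integrable_pow_gaussianReal 26).const_mul (2 ^ 26 / σ ^ 24)
  calc ∫ t, tailSq σ (2 * t) ∂gaussianReal 0 1
      ≤ ∫ t, 2 ^ 26 / σ ^ 24 * t ^ 26 ∂gaussianReal 0 1 :=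
        integral_mono_of_nonneg (Filter.Eventually.of_forall fun t => tailSq_nonneg _) hi
          (Filter.Eventually.of_forall fun t => tailSq_two_mul_le hσ t)
    _ = _ := by rw [integral_const_mul]; ring

lemma huber_of_abs_le {t : ℝ} (h : |t| ≤ T) : huber T t = t ^ 2 := by
  simp [huber, tailSq, max_eq_right (sub_nonpos.2 h)]

lemma huber_of_le_abs {t : ℝ} (h : T ≤ |t|) : huber T t = 2 * T * |t| - T ^ 2 := by
  rw [huber, tailSq, max_eq_left (sub_nonneg.2 h), ← sq_abs t]; ring

/-- `tailSq` is the squared distance to [-T, T], hence at most (t - c)². The Huber function is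
therefore a supremum of affine functions, which gives its convexity. -/
lemma tangent_le_huber {c : ℝ} (hc : |c| ≤ T) (t : ℝ) : 2 * c * t - c ^ 2 ≤ huber T t := by
  have h1 : max (|t| - T) 0 ≤ |t - c| :=
    max_le (by linarith [abs_sub_abs_le_abs_sub t c]) (abs_nonneg _)
  have h2 := pow_le_pow_left₀ (le_max_right _ _) h1 2
  rw [sq_abs] at h2
  unfold huber tailSq
  nlinarith

lemma exists_tangent_eq_huber (hT : 0 ≤ T) (t : ℝ) :
    ∃ c, |c| ≤ T ∧ huber T t = 2 * c * t - c ^ 2 := by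
  rcases le_total |t| T with h | h
  · exact ⟨t, h, by rw [huber_of_abs_le h]; ring⟩
  · rw [huber_of_le_abs h]
    rcases abs_cases t with ⟨h1, _⟩ | ⟨h1, _⟩
    · exact ⟨T, (abs_of_nonneg hT).le, by rw [h1]⟩
    · exact ⟨-T, by rw [abs_neg, abs_of_nonneg hT], by rw [h1]; ring⟩

lemma huber_nonneg (hT : 0 ≤ T) (t : ℝ) : 0 ≤ huber T t := by
  simpa using tangent_le_huber (c := 0) (by simpa) t

lemma convexOn_huber (hT : 0 ≤ T) : ConvexOn ℝ Set.univ (huber T) := by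
  refine ⟨convex_univ, fun s _ t _ a b ha hb hab => ?_⟩
  obtain ⟨c, hc, h⟩ := exists_tangent_eq_huber hT (a • s + b • t)
  rw [h]
  have h1 := mul_le_mul_of_nonneg_left (tangent_le_huber hc s) ha
  have h2 := mul_le_mul_of_nonneg_left (tangent_le_huber hc t) hb
  have h3 : c ^ 2 = a * c ^ 2 + b * c ^ 2 := by rw [← add_mul, hab, one_mul]
  simp only [smul_eq_mul] at *
  nlinarith

lemma convexOn_huber_sq (hT : 0 ≤ T) : ConvexOn ℝ Set.univ fun t => huber T t ^ 2 :=
  (convexOn_huber hT).pow (fun t _ => huber_nonneg hT t) 2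

lemma measurable_huber : Measurable (huber T) :=
  (measurable_id.pow_const 2).sub measurable_tailSq

lemma huber_mono (hT : 0 ≤ T) {s t : ℝ} (h : |s| ≤ |t|) : huber T s ≤ huber T t := by
  have hs := abs_nonneg s
  rcases le_total |s| T with h1 | h1 <;> rcases le_total |t| T with h2 | h2
  · rw [huber_of_abs_le h1, huber_of_abs_le h2]; exact sq_le_sq.2 h
  · rw [huber_of_abs_le h1, huber_of_le_abs h2, ← sq_abs s]; nlinarith
  · rw [huber_of_le_abs h1, huber_of_abs_le h2, ← sq_abs t]; nlinarith
  · rw [huber_of_le_abs h1, huber_of_le_abs h2]; nlinarith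

lemma huber_le_sq (t : ℝ) : huber T t ≤ t ^ 2 := sub_le_self _ (tailSq_nonneg t)

lemma huber_sq_le (hT : 0 ≤ T) (t : ℝ) : huber T t ^ 2 ≤ 4 * T ^ 2 * t ^ 2 := by
  have h : huber T t ≤ 2 * T * |t| := by
    rcases le_total |t| T with h | h
    · rw [huber_of_abs_le h, ← sq_abs]; nlinarith [abs_nonneg t]
    · rw [huber_of_le_abs h]; nlinarith
  calc huber T t ^ 2 ≤ (2 * T * |t|) ^ 2 := pow_le_pow_left₀ (huber_nonneg hT t) h 2
    _ = _ := by rw [mul_pow, sq_abs]; ring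

lemma integral_huber_sq_le (hT : 0 ≤ T) (r : ℝ) :
    ∫ t, huber T (r * t) ^ 2 ∂gaussianReal 0 1 ≤ 3 * r ^ 4 := by
  have hi := (integrable_pow_gaussianReal 4).const_mul (r ^ 4)
  calc ∫ t, huber T (r * t) ^ 2 ∂gaussianReal 0 1
      ≤ ∫ t, r ^ 4 * t ^ 4 ∂gaussianReal 0 1 :=
        integral_mono_of_nonneg (Filter.Eventually.of_forall fun t => sq_nonneg _) hi
          (Filter.Eventually.of_forall fun t =>
            (pow_le_pow_left₀ (huber_nonneg hT _) (huber_le_sq _) 2).trans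
              (le_of_eq (by ring)))
    _ = _ := by rw [integral_const_mul, integral_pow_four_gaussianReal]; ring

end TestFunctions

/-! ### Second derivative of a single summand. -/

section Term

/-- The second derivative of the `k`-th summand of the loss, in terms of `p = ⟨aₖ, z⟩`,
`q = ⟨aₖ, v⟩`, `s = ⟨aₖ, x⟩`, `N = ‖z‖²`, `b = ⟨z, v⟩` and the values `h₀, h₁, h₂` of the
activation function and its derivatives, for a unit vector `v`. -/
noncomputable def termSecond (p q s N b h₀ h₁ h₂ : ℝ) : ℝ :=
  4 * q ^ 2 * (3 * p ^ 2 - s ^ 2) * h₀ +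
    (8 * p * q * (p ^ 2 - s ^ 2) * (h₁ * (2 * p * q / N - 2 * p ^ 2 * b / N ^ 2)) +
      (p ^ 2 - s ^ 2) ^ 2 * (h₂ * (2 * p * q / N - 2 * p ^ 2 * b / N ^ 2) ^ 2 +
        h₁ * (2 * q ^ 2 / N - 8 * p * q * b / N ^ 2 - 2 * p ^ 2 / N ^ 2 +
          8 * p ^ 2 * b ^ 2 / N ^ 3)))

/-- Homogeneity, used to reduce to ‖x‖ = 1. -/
lemma termSecond_smul {X : ℝ} (hX : X ≠ 0) {N : ℝ} (hN : N ≠ 0) (p q s b h₀ h₁ h₂ : ℝ) :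
    termSecond (X * p) q (X * s) (X ^ 2 * N) (X * b) h₀ h₁ h₂ =
      X ^ 2 * termSecond p q s N b h₀ h₁ h₂ := by
  unfold termSecond
  field_simp

/-- For a unit vector v, the denominator N + 2tb + t² is ‖z + tv‖². -/
lemma hasDerivAt_term {H : ℝ → ℝ} (hH : Differentiable ℝ H) (p q s N b t : ℝ)
    (hN : N + 2 * t * b + t ^ 2 ≠ 0) :
    HasDerivAt (fun t => ((p + t * q) ^ 2 - s ^ 2) ^ 2 * H ((p + t * q) ^ 2 / (N + 2 * t * b + t ^ 2)))
      (4 * (p + t * q) * q * ((p + t * q) ^ 2 - s ^ 2) *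
          H ((p + t * q) ^ 2 / (N + 2 * t * b + t ^ 2)) +
        ((p + t * q) ^ 2 - s ^ 2) ^ 2 *
          (deriv H ((p + t * q) ^ 2 / (N + 2 * t * b + t ^ 2)) *
            (2 * (p + t * q) * q / (N + 2 * t * b + t ^ 2) -
              (p + t * q) ^ 2 * (2 * b + 2 * t) / (N + 2 * t * b + t ^ 2) ^ 2))) t := by
  have hp : HasDerivAt (fun t : ℝ => p + t * q) q t := by
    simpa using ((hasDerivAt_id t).mul_const q).const_add p
  have hn : HasDerivAt (fun t : ℝ => N + 2 * t * b + t ^ 2) (2 * b + 2 * t) t := by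
    have h1 := ((((hasDerivAt_id t).const_mul 2).mul_const b).const_add N).add
      ((hasDerivAt_id t).pow 2)
    refine h1.congr_deriv ?_
    simp
  have hu := (hp.pow 2).div hn hN
  have h1 := (((hp.pow 2).sub_const (s ^ 2)).pow 2).mul ((hH _).hasDerivAt.comp t hu)
  refine h1.congr_deriv ?_
  simp only [Function.comp_apply, Pi.div_apply, Pi.pow_apply]
  field_simp
  ring

lemma hasDerivAt_deriv_term {H : ℝ → ℝ} (hH : Differentiable ℝ H)
    (hH' : Differentiable ℝ (deriv H)) (p q s b : ℝ) {N : ℝ} (hN : N ≠ 0) :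
    HasDerivAt (fun t : ℝ => 4 * (p + t * q) * q * ((p + t * q) ^ 2 - s ^ 2) *
          H ((p + t * q) ^ 2 / (N + 2 * t * b + t ^ 2)) +
        ((p + t * q) ^ 2 - s ^ 2) ^ 2 *
          (deriv H ((p + t * q) ^ 2 / (N + 2 * t * b + t ^ 2)) *
            (2 * (p + t * q) * q / (N + 2 * t * b + t ^ 2) -
              (p + t * q) ^ 2 * (2 * b + 2 * t) / (N + 2 * t * b + t ^ 2) ^ 2)))
      (termSecond p q s N b (H (p ^ 2 / N)) (deriv H (p ^ 2 / N)) (deriv (deriv H) (p ^ 2 / N)))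
      0 := by
  have hN0 : N + 2 * 0 * b + 0 ^ 2 ≠ 0 := by simpa using hN
  have hp : HasDerivAt (fun t : ℝ => p + t * q) q 0 := by
    simpa using ((hasDerivAt_id (0 : ℝ)).mul_const q).const_add p
  have hn : HasDerivAt (fun t : ℝ => N + 2 * t * b + t ^ 2) (2 * b) 0 := by
    have h1 := ((((hasDerivAt_id (0 : ℝ)).const_mul 2).mul_const b).const_add N).add
      ((hasDerivAt_id (0 : ℝ)).pow 2)
    refine h1.congr_deriv ?_
    simp
  have hb : HasDerivAt (fun t : ℝ => 2 * b + 2 * t) 2 0 := by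
    simpa using ((hasDerivAt_id (0 : ℝ)).const_mul 2).const_add (2 * b)
  have hp2 : HasDerivAt (fun t : ℝ => (p + t * q) ^ 2) (2 * p * q) 0 := by
    refine (hp.pow 2).congr_deriv ?_
    simp
  have hu : HasDerivAt (fun t : ℝ => (p + t * q) ^ 2 / (N + 2 * t * b + t ^ 2))
      (2 * p * q / N - 2 * p ^ 2 * b / N ^ 2) 0 := by
    refine (hp2.div hn hN0).congr_deriv ?_
    simp only [zero_mul, mul_zero, add_zero, ne_eq, OfNat.ofNat_ne_zero, not_false_eq_true,
      zero_pow]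
    field_simp
  have e0 : (p + 0 * q) ^ 2 / (N + 2 * 0 * b + 0 ^ 2) = p ^ 2 / N := by simp
  have hHu : HasDerivAt (fun t : ℝ => H ((p + t * q) ^ 2 / (N + 2 * t * b + t ^ 2)))
      (deriv H (p ^ 2 / N) * (2 * p * q / N - 2 * p ^ 2 * b / N ^ 2)) 0 := by
    have := (hH ((p + 0 * q) ^ 2 / (N + 2 * 0 * b + 0 ^ 2))).hasDerivAt.comp 0 hu
    rwa [e0] at this
  have hHu' : HasDerivAt (fun t : ℝ => deriv H ((p + t * q) ^ 2 / (N + 2 * t * b + t ^ 2)))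
      (deriv (deriv H) (p ^ 2 / N) * (2 * p * q / N - 2 * p ^ 2 * b / N ^ 2)) 0 := by
    have := (hH' ((p + 0 * q) ^ 2 / (N + 2 * 0 * b + 0 ^ 2))).hasDerivAt.comp 0 hu
    rwa [e0] at this
  have hu1 : HasDerivAt (fun t : ℝ => 2 * (p + t * q) * q / (N + 2 * t * b + t ^ 2) -
              (p + t * q) ^ 2 * (2 * b + 2 * t) / (N + 2 * t * b + t ^ 2) ^ 2)
      (2 * q ^ 2 / N - 8 * p * q * b / N ^ 2 - 2 * p ^ 2 / N ^ 2 +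
          8 * p ^ 2 * b ^ 2 / N ^ 3) 0 := by
    refine ((((hp.const_mul 2).mul_const q).div hn hN0).sub
      ((hp2.mul hb).div (hn.pow 2) (pow_ne_zero 2 hN0))).congr_deriv ?_
    simp only [zero_mul, mul_zero, add_zero, ne_eq, OfNat.ofNat_ne_zero, not_false_eq_true,
      zero_pow, Pi.mul_apply, Pi.pow_apply]
    field_simp
    ring
  have h1 := (((hp.const_mul 4).mul_const q).mul (hp2.sub_const (s ^ 2))).mul hHu
  have h2 := ((hp2.sub_const (s ^ 2)).pow 2).mul (hHu'.mul hu1)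
  refine (h1.add h2).congr_deriv ?_
  simp only [zero_mul, mul_zero, add_zero, ne_eq, OfNat.ofNat_ne_zero, not_false_eq_true,
      zero_pow, Pi.mul_apply, Pi.pow_apply]
  unfold termSecond
  ring

end Term

/-! ### Lower bound for a single summand. -/

section TermBounds

/-- The square of the first derivative of the ratio p²/N. It follows from (α - α')² ≤ 2α² + 2α'²
with p²/N ≤ γ; the constant is 8 · 25/16 = 12.5, rounded up. -/
lemma ratio_deriv_sq_le {p q N b γ : ℝ} (hN1 : 16 / 25 ≤ N) (hb : b ^ 2 ≤ N) (hγ : 1 ≤ γ)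
    (hp : p ^ 2 ≤ γ * N) :
    (2 * p * q / N - 2 * p ^ 2 * b / N ^ 2) ^ 2 ≤ 13 * γ ^ 2 * (1 + q ^ 2) := by
  have hN0 : 0 < N := by linarith
  set u := p ^ 2 / N with hu
  have hu0 : 0 ≤ u := by positivity
  have huγ : u ≤ γ := by rw [hu, div_le_iff₀ hN0]; exact hp
  have hinv : 1 / N ≤ 25 / 16 := by rw [div_le_iff₀ hN0]; linarith
  have hq : 0 ≤ q ^ 2 := sq_nonneg q
  have hγγ : γ ≤ γ ^ 2 := by nlinarith
  have hb' : b ^ 2 / N ≤ 1 := by rw [div_le_one hN0]; exact hb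
  have hb0 : 0 ≤ b ^ 2 / N := by positivity
  have e2 : (8 * u * q ^ 2 + 8 * u ^ 2 * (b ^ 2 / N)) * (1 / N) -
      (2 * p * q / N - 2 * p ^ 2 * b / N ^ 2) ^ 2 =
      (2 * p * q / N + 2 * p ^ 2 * b / N ^ 2) ^ 2 := by
    rw [hu]; field_simp; ring
  have e3 : 8 * u * q ^ 2 + 8 * u ^ 2 * (b ^ 2 / N) ≤ 8 * γ ^ 2 * (1 + q ^ 2) := by
    have a1 : u * q ^ 2 ≤ γ ^ 2 * q ^ 2 := mul_le_mul_of_nonneg_right (huγ.trans hγγ) hq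
    have a2 : u ^ 2 * (b ^ 2 / N) ≤ γ ^ 2 * 1 :=
      mul_le_mul (pow_le_pow_left₀ hu0 huγ 2) hb' hb0 (by positivity)
    linarith
  have e4 := mul_le_mul e3 hinv (by positivity) (by positivity)
  have e5 : 0 ≤ γ ^ 2 * (1 + q ^ 2) := by positivity
  have e6 := sq_nonneg (2 * p * q / N + 2 * p ^ 2 * b / N ^ 2)
  linarith

lemma abs_ratio_second_le {p q N b γ : ℝ} (hN1 : 16 / 25 ≤ N) (hb : b ^ 2 ≤ N) (hγ : 1 ≤ γ)
    (hp : p ^ 2 ≤ γ * N) :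
    |2 * q ^ 2 / N - 8 * p * q * b / N ^ 2 - 2 * p ^ 2 / N ^ 2 + 8 * p ^ 2 * b ^ 2 / N ^ 3| ≤
      22 * γ ^ 2 * (1 + q ^ 2) := by
  have hN0 : 0 < N := by linarith
  have hγ0 : 0 < γ := by linarith
  set u := p ^ 2 / N with hu
  have hpu : p ^ 2 = u * N := by rw [hu]; field_simp
  have hu0 : 0 ≤ u := by positivity
  have huγ : u ≤ γ := by rw [hu, div_le_iff₀ hN0]; exact hp
  have hinv : 1 / N ≤ 25 / 16 := by rw [div_le_iff₀ hN0]; linarith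
  have hq : 0 ≤ q ^ 2 := sq_nonneg q
  have hγγ : γ ≤ γ ^ 2 := by nlinarith
  have hb' : b ^ 2 / N ≤ 1 := by rw [div_le_one hN0]; exact hb
  have hb0 : 0 ≤ b ^ 2 / N := by positivity
  have k1 : |8 * p * q * b / N ^ 2| ≤ (4 * q ^ 2 + 4 * u) * (1 / N) := by
    have k2 : |8 * p * q * b| ≤ 4 * (q ^ 2 * N) + 4 * (u * N) := by
      have k3 : q ^ 2 * b ^ 2 ≤ q ^ 2 * N := mul_le_mul_of_nonneg_left hb hq
      have k4 : 0 ≤ p ^ 2 + 2 * p * q * b + q ^ 2 * b ^ 2 := by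
        have := sq_nonneg (p + q * b); linarith
      have k5 : 0 ≤ p ^ 2 - 2 * p * q * b + q ^ 2 * b ^ 2 := by
        have := sq_nonneg (p - q * b); linarith
      rw [← hpu, abs_le]
      constructor <;> linarith
    rw [abs_div, abs_of_pos (by positivity : 0 < N ^ 2), div_le_iff₀ (by positivity)]
    refine k2.trans (le_of_eq ?_)
    field_simp
  have k4 : 2 * p ^ 2 / N ^ 2 = 2 * (u * (1 / N)) := by rw [hu]; field_simp
  have k5 : 8 * p ^ 2 * b ^ 2 / N ^ 3 = 8 * u * (b ^ 2 / N) * (1 / N) := by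
    rw [hu]; field_simp
  have k6 : 8 * u * (b ^ 2 / N) * (1 / N) ≤ 8 * u * 1 * (1 / N) := by gcongr
  have k7 : 0 ≤ 8 * u * (b ^ 2 / N) * (1 / N) := by positivity
  have k8 : 2 * q ^ 2 / N = 2 * (q ^ 2 * (1 / N)) := by ring
  have k9 : 0 ≤ q ^ 2 * (1 / N) := by positivity
  have k10 : 0 ≤ u * (1 / N) := by positivity
  have e1 : |2 * q ^ 2 / N - 8 * p * q * b / N ^ 2 - 2 * p ^ 2 / N ^ 2 +
      8 * p ^ 2 * b ^ 2 / N ^ 3| ≤ (6 * q ^ 2 + 14 * u) * (1 / N) := by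
    rw [k4, k5, k8]
    obtain ⟨k11, k12⟩ := abs_le.1 k1
    rw [abs_le]
    constructor <;> linarith
  refine e1.trans ?_
  have e2 : 6 * q ^ 2 + 14 * u ≤ 14 * γ ^ 2 * (1 + q ^ 2) := by
    have := mul_le_mul_of_nonneg_right (hγ.trans hγγ) hq
    linarith
  have e3 := mul_le_mul e2 hinv (by positivity) (by positivity)
  have e5 : 0 ≤ γ ^ 2 * (1 + q ^ 2) := by positivity
  linarith

/-- The contribution of the derivatives of the activation function. -/
lemma abs_derivative_part_le {p q s N b h₁ h₂ M γ W : ℝ} (hN1 : 16 / 25 ≤ N) (hN2 : N ≤ 36 / 25)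
    (hb : b ^ 2 ≤ N) (hγ : 1 ≤ γ) (hp : p ^ 2 ≤ γ * N) (hs : s ^ 2 ≤ W) (hW : 4 * γ ≤ W)
    (h1 : |h₁| ≤ M) (h2 : |h₂| ≤ M) :
    |8 * p * q * (p ^ 2 - s ^ 2) * (h₁ * (2 * p * q / N - 2 * p ^ 2 * b / N ^ 2)) +
      (p ^ 2 - s ^ 2) ^ 2 * (h₂ * (2 * p * q / N - 2 * p ^ 2 * b / N ^ 2) ^ 2 +
        h₁ * (2 * q ^ 2 / N - 8 * p * q * b / N ^ 2 - 2 * p ^ 2 / N ^ 2 +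
          8 * p ^ 2 * b ^ 2 / N ^ 3))| ≤ 100 * M * γ ^ 2 * W ^ 2 * (1 + q ^ 2) := by
  have hM : 0 ≤ M := (abs_nonneg _).trans h1
  have hγ0 : 0 < γ := by linarith
  have hW0 : 4 ≤ W := by linarith
  have hU1b := ratio_deriv_sq_le (q := q) hN1 hb hγ hp
  have hU2b := abs_ratio_second_le (q := q) hN1 hb hγ hp
  generalize 2 * p * q / N - 2 * p ^ 2 * b / N ^ 2 = U1 at hU1b ⊢
  generalize 2 * q ^ 2 / N - 8 * p * q * b / N ^ 2 - 2 * p ^ 2 / N ^ 2 +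
          8 * p ^ 2 * b ^ 2 / N ^ 3 = U2 at hU2b ⊢
  have hq : 0 ≤ q ^ 2 := sq_nonneg q
  have hp' : p ^ 2 ≤ 2 * γ := by nlinarith
  have hd : |p ^ 2 - s ^ 2| ≤ W := by
    rw [abs_le]
    have := sq_nonneg p
    have := sq_nonneg s
    constructor <;> linarith
  have hp2 : p ^ 2 ≤ 2 * γ ^ 2 := by nlinarith
  have hpq : |p * q * U1| ≤ 8 * (γ ^ 2 * (1 + q ^ 2)) := by
    have k1 : (p * q) ^ 2 ≤ 2 * γ ^ 2 * q ^ 2 := by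
      rw [mul_pow]; exact mul_le_mul_of_nonneg_right hp2 hq
    have k2 : 0 ≤ (p * q) ^ 2 + 2 * (p * q * U1) + U1 ^ 2 := by
      have := sq_nonneg (p * q + U1); linarith
    have k3 : 0 ≤ (p * q) ^ 2 - 2 * (p * q * U1) + U1 ^ 2 := by
      have := sq_nonneg (p * q - U1); linarith
    have := sq_nonneg γ
    rw [abs_le]
    constructor <;> linarith
  set Z := γ ^ 2 * (1 + q ^ 2) with hZ
  have hZ0 : 0 ≤ Z := by positivity
  have t1 : |8 * p * q * (p ^ 2 - s ^ 2) * (h₁ * U1)| ≤ 64 * (W * M * Z) := by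
    have e : 8 * p * q * (p ^ 2 - s ^ 2) * (h₁ * U1) = 8 * ((p ^ 2 - s ^ 2) * h₁ * (p * q * U1)) := by
      ring
    rw [e, abs_mul, abs_mul, abs_mul (p ^ 2 - s ^ 2), abs_of_pos (by norm_num : (0 : ℝ) < 8)]
    have := mul_le_mul (mul_le_mul hd h1 (abs_nonneg _) (by linarith)) hpq (abs_nonneg _)
      (by positivity)
    linarith
  have hd2 : (p ^ 2 - s ^ 2) ^ 2 ≤ W ^ 2 := by
    rw [← sq_abs]; exact pow_le_pow_left₀ (abs_nonneg _) hd 2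
  have t2 : |h₂ * U1 ^ 2 + h₁ * U2| ≤ M * (35 * Z) := by
    have a1 : |h₂ * U1 ^ 2| ≤ M * (13 * Z) := by
      rw [abs_mul, abs_of_nonneg (sq_nonneg U1)]
      exact mul_le_mul h2 (by rw [hZ]; linarith) (sq_nonneg _) hM
    have a2 : |h₁ * U2| ≤ M * (22 * Z) := by
      rw [abs_mul]
      exact mul_le_mul h1 (by rw [hZ]; linarith) (abs_nonneg _) hM
    have := abs_add_le (h₂ * U1 ^ 2) (h₁ * U2)
    linarith
  have t3 : |(p ^ 2 - s ^ 2) ^ 2 * (h₂ * U1 ^ 2 + h₁ * U2)| ≤ W ^ 2 * (M * (35 * Z)) := by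
    rw [abs_mul, abs_of_nonneg (sq_nonneg _)]
    exact mul_le_mul hd2 t2 (abs_nonneg _) (by positivity)
  have hMZ : 0 ≤ M * Z := mul_nonneg hM hZ0
  have hWW : 4 * W ≤ W ^ 2 := by nlinarith
  have t4 := mul_le_mul_of_nonneg_right hWW hMZ
  have t5 : 0 ≤ W ^ 2 * (M * Z) := by positivity
  have t6 := (abs_add_le _ _).trans (add_le_add t1 t3)
  refine t6.trans ?_
  have e : 100 * M * γ ^ 2 * W ^ 2 * (1 + q ^ 2) = 100 * (W ^ 2 * (M * Z)) := by rw [hZ]; ring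
  rw [e]
  linarith

/-- The indicator of `2σ ≤ |t|`. -/
noncomputable def bigInd (σ t : ℝ) : ℝ := if 2 * σ ≤ |t| then 1 else 0

lemma bigInd_nonneg (σ t : ℝ) : 0 ≤ bigInd σ t := by unfold bigInd; split_ifs <;> norm_num

lemma bigInd_of_sq_le {σ t : ℝ} (h : (2 * σ) ^ 2 ≤ t ^ 2) (hσ : 0 ≤ σ) : bigInd σ t = 1 := by
  have := sq_le_sq.1 h
  rw [abs_of_nonneg (by linarith)] at this
  simp [bigInd, this]

lemma bigInd_mul_sq_le {σ : ℝ} (hσ : 0 ≤ σ) (t : ℝ) : σ ^ 2 * bigInd σ t ≤ tailSq σ t := by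
  unfold bigInd
  split_ifs with h
  · rw [tailSq, max_eq_left (by linarith), mul_one]
    exact pow_le_pow_left₀ hσ (by linarith) 2
  · simpa using tailSq_nonneg t

lemma sq_le_tailSq {σ : ℝ} (t : ℝ) : t ^ 2 ≤ 2 * tailSq σ t + 2 * σ ^ 2 := by
  rw [tailSq, ← sq_abs t]
  have h1 : |t| ≤ max (|t| - σ) 0 + σ := by linarith [le_max_left (|t| - σ) 0]
  have h2 := pow_le_pow_left₀ (abs_nonneg t) h1 2
  nlinarith [sq_nonneg (max (|t| - σ) 0 - σ)]

/-- Lower bound for one summand, in normalised coordinates `‖x‖ = 1`; here `p' = ⟨aₖ, z⟩/‖z‖`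
and `t = 5⟨aₖ, z - x⟩`. -/
lemma termSecond_lower {β γ M σ W : ℝ} {H : ℝ → ℝ} (hH : IsSmoothCutoff β γ M H) (hσ : 1 ≤ σ)
    (hβ : β = 32 * σ ^ 4) (hβγ : β < γ) (hW : W = 4 * σ ^ 2 * γ) {p q s N b c t p' : ℝ}
    (hN1 : 16 / 25 ≤ N) (hN2 : N ≤ 36 / 25) (hb : b ^ 2 ≤ N) (hpp : p' ^ 2 = p ^ 2 / N)
    (ht : p = s + t / 5) (hc0 : 0 ≤ c) (hc1 : c ≤ 1) (hcs : c ≠ 0 → s ^ 2 ≤ W)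
    (hcone : s ^ 2 ≤ 4 * σ ^ 2 → c = 1) :
    4 * (min (s ^ 2) (4 * σ ^ 2) * q ^ 2)
        - 16 * σ ^ 2 * (q ^ 2 * bigInd σ p' + q ^ 2 * bigInd σ s)
        - 24 / 50 * (huber (2 * σ) q ^ 2 + huber (2 * σ) t ^ 2)
        - 384 * σ ^ 2 * γ * (q ^ 2 * bigInd σ q + q ^ 2 * bigInd σ t)
        - 100 * M * γ ^ 2 * W ^ 2 * (bigInd σ p' + q ^ 2 * bigInd σ p') ≤
      termSecond p q s N b (H (p ^ 2 / N)) (deriv H (p ^ 2 / N)) (deriv (deriv H) (p ^ 2 / N)) *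
        c := by
  have hN0 : 0 < N := by linarith
  have hσ2 : 1 ≤ σ ^ 2 := by nlinarith
  have hσ4 : σ ^ 2 ≤ σ ^ 4 := by nlinarith
  have hβ1 : 4 * σ ^ 2 ≤ β := by nlinarith
  have hγ1 : 1 ≤ γ := by nlinarith
  have hW4 : 4 * γ ≤ W := by rw [hW]; nlinarith
  have hM : 0 ≤ M := (abs_nonneg _).trans (hH.abs_deriv_le 0)
  have hq : 0 ≤ q ^ 2 := sq_nonneg q
  set u := p ^ 2 / N with hu
  have hind : β ≤ u → bigInd σ p' = 1 := fun h =>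
    bigInd_of_sq_le (by rw [hpp]; nlinarith) (by linarith)
  have hi0 := bigInd_nonneg σ p'
  have hs0 := bigInd_nonneg σ s
  have hq0 := bigInd_nonneg σ q
  have ht0 := bigInd_nonneg σ t
  -- the part with derivatives of the activation function
  set D := 8 * p * q * (p ^ 2 - s ^ 2) * (deriv H u * (2 * p * q / N - 2 * p ^ 2 * b / N ^ 2)) +
      (p ^ 2 - s ^ 2) ^ 2 * (deriv (deriv H) u * (2 * p * q / N - 2 * p ^ 2 * b / N ^ 2) ^ 2 +
        deriv H u * (2 * q ^ 2 / N - 8 * p * q * b / N ^ 2 - 2 * p ^ 2 / N ^ 2 +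
          8 * p ^ 2 * b ^ 2 / N ^ 3)) with hD
  have hL0 : 0 ≤ 100 * M * γ ^ 2 * W ^ 2 := by positivity
  have hDc : -(100 * M * γ ^ 2 * W ^ 2 * (bigInd σ p' + q ^ 2 * bigInd σ p')) ≤ D * c := by
    have hneg : -(100 * M * γ ^ 2 * W ^ 2 * (bigInd σ p' + q ^ 2 * bigInd σ p')) ≤ 0 := by
      have : 0 ≤ bigInd σ p' + q ^ 2 * bigInd σ p' := by positivity
      have := mul_nonneg hL0 this
      linarith
    by_cases hcz : c = 0
    · rw [hcz, mul_zero]; exact hneg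
    by_cases hout : u < β ∨ γ < u
    · obtain ⟨e1, e2⟩ := hH.deriv_eq_zero hout
      have : D = 0 := by rw [hD, e1, e2]; ring
      rw [this, zero_mul]; exact hneg
    · push Not at hout
      have hp : p ^ 2 ≤ γ * N := by
        have := hout.2
        rwa [hu, div_le_iff₀ hN0] at this
      have hab := abs_derivative_part_le (q := q) hN1 hN2 hb hγ1 hp (hcs hcz) hW4
        (hH.abs_deriv_le u) (hH.abs_deriv_deriv_le u)
      rw [← hD] at hab
      have h3 : |D * c| ≤ 100 * M * γ ^ 2 * W ^ 2 * (1 + q ^ 2) := by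
        rw [abs_mul, abs_of_nonneg hc0]
        exact (mul_le_of_le_one_right (abs_nonneg D) hc1).trans hab
      rw [hind hout.1, mul_one]
      exact (abs_le.1 h3).1
  -- the main part
  set g := H u * c with hg
  have hH0 := hH.nonneg u
  have hH1 := hH.le_one u
  have hg0 : 0 ≤ g := mul_nonneg hH0 hc0
  have hg1 : g ≤ 1 := mul_le_one₀ hH1 hc0 hc1
  -- If u ≤ β and s² ≤ 4σ², both cutoffs are 1. Otherwise p' or s has size at least 2σ and its
  -- indicator term absorbs the minimum.
  have hmain1 : min (s ^ 2) (4 * σ ^ 2) * q ^ 2 - 4 * σ ^ 2 * (q ^ 2 * bigInd σ p' +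
      q ^ 2 * bigInd σ s) ≤ g * (q ^ 2 * s ^ 2) := by
    have hR : 0 ≤ g * (q ^ 2 * s ^ 2) := by positivity
    have hm2 : min (s ^ 2) (4 * σ ^ 2) * q ^ 2 ≤ 4 * σ ^ 2 * q ^ 2 :=
      mul_le_mul_of_nonneg_right (min_le_right _ _) hq
    have n1 : 0 ≤ σ ^ 2 * (q ^ 2 * bigInd σ p') := by positivity
    have n2 : 0 ≤ σ ^ 2 * (q ^ 2 * bigInd σ s) := by positivity
    rcases le_or_gt u β with h1 | h1
    · rcases le_or_gt (s ^ 2) (4 * σ ^ 2) with h2 | h2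
      · have : g = 1 := by rw [hg, hH.eq_one u h1, hcone h2, one_mul]
        rw [this, min_eq_left h2]
        linarith
      · rw [bigInd_of_sq_le (t := s) (by linarith) (by linarith)] at n2 ⊢
        linarith
    · rw [hind h1.le] at n1 ⊢
      linarith
  -- For |q|, |t| < 2σ this is q²t² ≤ (q⁴ + t⁴)/2, and the Huber functions are exact squares.
  -- Otherwise an indicator is 1.
  have hmain2 : g * (q ^ 2 * (t / 5) ^ 2) ≤ 1 / 50 * (huber (2 * σ) q ^ 2 + huber (2 * σ) t ^ 2) +
      16 * σ ^ 2 * γ * (q ^ 2 * bigInd σ q + q ^ 2 * bigInd σ t) := by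
    have n1 : 0 ≤ σ ^ 2 * γ * (q ^ 2 * bigInd σ q) := by positivity
    have n2 : 0 ≤ σ ^ 2 * γ * (q ^ 2 * bigInd σ t) := by positivity
    by_cases hsmall : |q| < 2 * σ ∧ |t| < 2 * σ
    · rw [huber_of_abs_le hsmall.1.le, huber_of_abs_le hsmall.2.le]
      have h1 : g * (q ^ 2 * (t / 5) ^ 2) ≤ 1 * (q ^ 2 * (t / 5) ^ 2) :=
        mul_le_mul_of_nonneg_right hg1 (by positivity)
      have h2 := sq_nonneg (q ^ 2 - t ^ 2)
      linarith
    · have hone : 1 ≤ bigInd σ q + bigInd σ t := by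
        by_cases h : |q| < 2 * σ
        · have : 2 * σ ≤ |t| := by
            by_contra h'; exact hsmall ⟨h, not_le.1 h'⟩
          have : bigInd σ t = 1 := by simp [bigInd, this]
          linarith
        · have : bigInd σ q = 1 := by simp [bigInd, not_lt.1 h]
          linarith
      -- A nonzero g forces p² ≤ γN and s² ≤ W, which bounds p - s = t/5.
      have hbd : g * (t / 5) ^ 2 ≤ 16 * σ ^ 2 * γ := by
        by_cases hgz : g = 0
        · rw [hgz, zero_mul]; positivity
        · have hcz : c ≠ 0 := fun h => hgz (by rw [hg, h, mul_zero])
          have hu1 : u < γ := by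
            by_contra h
            exact hgz (by rw [hg, hH.eq_zero u (not_lt.1 h), zero_mul])
          have hp : p ^ 2 ≤ γ * N := by
            rw [hu, div_lt_iff₀ hN0] at hu1; exact hu1.le
          have h2 := hcs hcz
          have h3 : (t / 5) ^ 2 ≤ 2 * (p ^ 2 + s ^ 2) := by
            have e : t / 5 = p - s := by linarith
            have := sq_nonneg (p + s)
            rw [e]; linarith
          have h4 : (t / 5) ^ 2 ≤ 4 * W := by
            have := mul_le_mul_of_nonneg_left hN2 (by linarith : 0 ≤ γ)
            linarith
          calc g * (t / 5) ^ 2 ≤ 1 * (t / 5) ^ 2 := mul_le_mul_of_nonneg_right hg1 (sq_nonneg _)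
            _ ≤ 4 * W := by linarith
            _ = _ := by rw [hW]; ring
      have hk : 0 ≤ 16 * σ ^ 2 * γ * q ^ 2 := by positivity
      have h5 := mul_le_mul_of_nonneg_right hbd hq
      have h6 := mul_le_mul_of_nonneg_left hone hk
      have h7 := sq_nonneg (huber (2 * σ) q)
      have h8 := sq_nonneg (huber (2 * σ) t)
      linarith
  -- With p = s + d, the difference of the two sides is (s + 3d)².
  have hsq : s ^ 2 - 6 * (t / 5) ^ 2 ≤ 3 * p ^ 2 - s ^ 2 := by
    have := sq_nonneg (s + 3 * (t / 5))
    rw [ht]; linarith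
  have hfin : g * (4 * q ^ 2 * (s ^ 2 - 6 * (t / 5) ^ 2)) ≤ g * (4 * q ^ 2 * (3 * p ^ 2 - s ^ 2)) := by
    gcongr
  have hT : termSecond p q s N b (H u) (deriv H u) (deriv (deriv H) u) * c =
      g * (4 * q ^ 2 * (3 * p ^ 2 - s ^ 2)) + D * c := by
    rw [hD, hg]; unfold termSecond; ring
  rw [hT]
  linarith

end TermBounds

/-! ### Second derivative of the whole loss. -/

section CutoffLoss

variable {n m : ℕ}

/-- The loss function for a smooth cutoff `H` and fixed weights `c`. -/
noncomputable def cutoffLoss (H : ℝ → ℝ) (c : Fin m → ℝ) (a : Fin m → EuclideanSpace ℝ (Fin n))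
    (x z : EuclideanSpace ℝ (Fin n)) : ℝ :=
  1 / (2 * (m : ℝ)) * ∑ k, (((inner ℝ (a k) z) ^ 2 - (inner ℝ (a k) x) ^ 2) ^ 2
    * H ((inner ℝ (a k) z) ^ 2 / ‖z‖ ^ 2)) * c k

/-- The weights `h(m⟨aₖ, x⟩² / ‖y‖₁)`. -/
noncomputable def weight (H : ℝ → ℝ) (a : Fin m → EuclideanSpace ℝ (Fin n))
    (x : EuclideanSpace ℝ (Fin n)) (k : Fin m) : ℝ :=
  H ((m : ℝ) * (inner ℝ (a k) x) ^ 2 / ∑ j, (inner ℝ (a j) x) ^ 2)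

/-- The second activation factor does not involve z, so it enters the derivatives as a constant
weight. -/
lemma loss_eq_cutoffLoss {β γ M : ℝ} {h : ℝ → ℝ} (hβ : 0 < β) (hh : IsActivation β γ M h)
    (a : Fin m → EuclideanSpace ℝ (Fin n)) (x : EuclideanSpace ℝ (Fin n)) :
    loss h a x = cutoffLoss (extendOne h) (weight (extendOne h) a x) a x := by
  ext z
  unfold loss cutoffLoss weight measurement
  congr 1
  refine Finset.sum_congr rfl fun k _ => ?_
  have e : ∑ j, |(fun k => |inner ℝ (a k) x| ^ 2) j| = ∑ j, (inner ℝ (a j) x) ^ 2 :=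
    Finset.sum_congr rfl fun j _ => by simp
  rw [e, sq_abs, sq_abs, hh.extendOne_eq hβ (by positivity),
    hh.extendOne_eq hβ (div_nonneg (by positivity) (Finset.sum_nonneg fun j _ => sq_nonneg _))]

variable {H : ℝ → ℝ} (c : Fin m → ℝ) (a : Fin m → EuclideanSpace ℝ (Fin n))
  (x : EuclideanSpace ℝ (Fin n)) {z : EuclideanSpace ℝ (Fin n)}

lemma twiceDifferentiableAt_cutoffLoss (hH : Differentiable ℝ H)
    (hH' : Differentiable ℝ (deriv H)) (hz : z ≠ 0) :
    TwiceDifferentiableAt (cutoffLoss H c a x) z := by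
  have hconst : ∀ r : ℝ, TwiceDifferentiableAt (fun _ => r) z := fun r =>
    .of_contDiffAt contDiffAt_const
  refine (hconst _).mul (.sum fun k _ => .mul (.mul ?_ (.comp hH hH' ?_)) (hconst _))
  · exact .of_contDiffAt ((((contDiffAt_const.inner ℝ contDiffAt_id).pow 2).sub
      contDiffAt_const).pow 2)
  · refine .of_contDiffAt (ContDiffAt.div ((contDiffAt_const.inner ℝ contDiffAt_id).pow 2) ?_ ?_)
    · exact (contDiff_norm_sq ℝ).contDiffAt
    · simpa using hz

lemma fderiv_fderiv_cutoffLoss (hH : Differentiable ℝ H)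
    (hH' : Differentiable ℝ (deriv H)) (hz : z ≠ 0) {v : EuclideanSpace ℝ (Fin n)}
    (hv : ‖v‖ = 1) :
    fderiv ℝ (fderiv ℝ (cutoffLoss H c a x)) z v v = 1 / (2 * (m : ℝ)) * ∑ k,
      termSecond (inner ℝ (a k) z) (inner ℝ (a k) v) (inner ℝ (a k) x) (‖z‖ ^ 2) (inner ℝ z v)
        (H ((inner ℝ (a k) z) ^ 2 / ‖z‖ ^ 2)) (deriv H ((inner ℝ (a k) z) ^ 2 / ‖z‖ ^ 2))
        (deriv (deriv H) ((inner ℝ (a k) z) ^ 2 / ‖z‖ ^ 2)) * c k := by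
  have hN : ‖z‖ ^ 2 ≠ 0 := by simpa using hz
  refine (twiceDifferentiableAt_cutoffLoss c a x hH hH' hz).fderiv_fderiv_apply_eq v ?_
    (HasDerivAt.const_mul _ (HasDerivAt.fun_sum fun k _ =>
      (hasDerivAt_deriv_term hH hH' _ _ _ (inner ℝ z v) hN).mul_const (c k)))
  have hev : ∀ᶠ t : ℝ in 𝓝 0, ‖z‖ ^ 2 + 2 * t * inner ℝ z v + t ^ 2 ≠ 0 := by
    have hc : Continuous fun t : ℝ => ‖z‖ ^ 2 + 2 * t * inner ℝ z v + t ^ 2 := by fun_prop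
    exact hc.continuousAt.eventually_ne (by simpa using hz)
  filter_upwards [hev] with t ht
  have e : (fun s : ℝ => cutoffLoss H c a x (z + s • v)) = fun s : ℝ => 1 / (2 * (m : ℝ)) * ∑ k,
      (((inner ℝ (a k) z + s * inner ℝ (a k) v) ^ 2 - (inner ℝ (a k) x) ^ 2) ^ 2 *
        H ((inner ℝ (a k) z + s * inner ℝ (a k) v) ^ 2 /
          (‖z‖ ^ 2 + 2 * s * inner ℝ z v + s ^ 2))) * c k := by
    ext s
    unfold cutoffLoss
    congr 1
    refine Finset.sum_congr rfl fun k _ => ?_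
    have e1 : ‖z + s • v‖ ^ 2 = ‖z‖ ^ 2 + 2 * s * inner ℝ z v + s ^ 2 := by
      rw [norm_add_sq_real, norm_smul, hv, real_inner_smul_right, mul_one, Real.norm_eq_abs, sq_abs]
      ring
    rw [e1, inner_add_right, real_inner_smul_right]
  rw [e]
  exact HasDerivAt.const_mul _ (HasDerivAt.fun_sum fun k _ =>
    (hasDerivAt_term hH _ _ _ _ _ t ht).mul_const (c k))

end CutoffLoss

/-! ### The deterministic argument on regular samples. -/

section Regular

variable {n m : ℕ}

/-- The event of the theorem: uniform bounds for the tails and the truncated fourth powers of the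
projections of the sample, and for the quadratic form weighted by the projections on `x`. -/
structure IsRegular (σ δ : ℝ) (x : EuclideanSpace ℝ (Fin n))
    (a : Fin m → EuclideanSpace ℝ (Fin n)) : Prop where
  tail : ∀ v : EuclideanSpace ℝ (Fin n), ‖v‖ ≤ 1 → ∑ k, tailSq σ (inner ℝ (a k) v) ≤ δ * m
  quartic : ∀ v : EuclideanSpace ℝ (Fin n), ‖v‖ ≤ 1 →
    ∑ k, huber (2 * σ) (inner ℝ (a k) v) ^ 2 ≤ 335 / 100 * m
  lower : ∀ v : EuclideanSpace ℝ (Fin n), ‖v‖ = 1 →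
    95 / 100 * m ≤ ∑ k, min ((inner ℝ (a k) x) ^ 2) (4 * σ ^ 2) * (inner ℝ (a k) v) ^ 2

/-- Serves twice: it bounds ‖y‖₁ from above and supplies the constant K of `exists_uniform_lower`.
-/
lemma sum_sq_le_of_tail {σ δ : ℝ} {a : Fin m → EuclideanSpace ℝ (Fin n)} (hσ : 1 ≤ σ)
    (hδ : δ ≤ 1) {v : EuclideanSpace ℝ (Fin n)}
    (hv : ∑ k, tailSq σ (inner ℝ (a k) v) ≤ δ * m) :
    ∑ k, (inner ℝ (a k) v) ^ 2 ≤ 4 * σ ^ 2 * m := by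
  have h1 : ∑ k, (inner ℝ (a k) v) ^ 2 ≤ ∑ k, (2 * tailSq σ (inner ℝ (a k) v) + 2 * σ ^ 2) :=
    Finset.sum_le_sum fun k _ => sq_le_tailSq _
  rw [Finset.sum_add_distrib, ← Finset.mul_sum, Finset.sum_const, Finset.card_univ,
    Fintype.card_fin, nsmul_eq_mul] at h1
  have hm : (0 : ℝ) ≤ m := Nat.cast_nonneg m
  have h2 := mul_le_mul_of_nonneg_right hδ hm
  have h3 := mul_le_mul_of_nonneg_right (one_le_pow₀ hσ : 1 ≤ σ ^ 2) hm
  linarith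

variable {σ δ : ℝ} {x : EuclideanSpace ℝ (Fin n)} {a : Fin m → EuclideanSpace ℝ (Fin n)}

lemma IsRegular.neg (hr : IsRegular σ δ x a) : IsRegular σ δ (-x) a :=
  ⟨hr.tail, hr.quartic, by simpa using hr.lower⟩

lemma IsRegular.sum_bigInd_le (hr : IsRegular σ δ x a) (hσ : 1 ≤ σ)
    {w : EuclideanSpace ℝ (Fin n)} (hw : ‖w‖ ≤ 1) :
    ∑ k, bigInd σ (inner ℝ (a k) w) ≤ δ * m := by
  refine (Finset.sum_le_sum fun k _ => ?_).trans (hr.tail w hw)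
  refine le_trans ?_ (bigInd_mul_sq_le (by linarith) _)
  exact le_mul_of_one_le_left (bigInd_nonneg _ _) (one_le_pow₀ hσ)

/-- In q² ≤ 2 `tailSq` + 2σ² the first part is charged to the tail of v and the second, times the
indicator, to the tail of w. No factor σ² is lost. -/
lemma IsRegular.sum_sq_bigInd_le (hr : IsRegular σ δ x a) (hσ : 1 ≤ σ)
    {v w : EuclideanSpace ℝ (Fin n)} (hv : ‖v‖ ≤ 1) (hw : ‖w‖ ≤ 1) :
    ∑ k, (inner ℝ (a k) v) ^ 2 * bigInd σ (inner ℝ (a k) w) ≤ 4 * δ * m := by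
  have h : ∀ k, (inner ℝ (a k) v) ^ 2 * bigInd σ (inner ℝ (a k) w) ≤
      2 * tailSq σ (inner ℝ (a k) v) + 2 * tailSq σ (inner ℝ (a k) w) := by
    intro k
    have h1 := mul_le_mul_of_nonneg_right (sq_le_tailSq (σ := σ) (inner ℝ (a k) v))
      (bigInd_nonneg σ (inner ℝ (a k) w))
    have h2 : bigInd σ (inner ℝ (a k) w) ≤ 1 := by unfold bigInd; split_ifs <;> norm_num
    have h3 := mul_le_mul_of_nonneg_left h2 (tailSq_nonneg (σ := σ) (inner ℝ (a k) v))
    have h4 := bigInd_mul_sq_le (by linarith : 0 ≤ σ) (inner ℝ (a k) w)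
    linarith
  refine (Finset.sum_le_sum fun k _ => h k).trans ?_
  rw [Finset.sum_add_distrib, ← Finset.mul_sum, ← Finset.mul_sum]
  have h1 := hr.tail v hv
  have h2 := hr.tail w hw
  linarith

/-- The weights are `1` at moderate projections and vanish at large ones. -/
lemma IsRegular.weight_spec {β γ M : ℝ} {H : ℝ → ℝ} (hH : IsSmoothCutoff β γ M H)
    (hr : IsRegular σ δ x a) (hx : ‖x‖ = 1) (hm : 0 < m) (hσ : 1 ≤ σ) (hδ : δ ≤ 1)
    (hβ : β = 32 * σ ^ 4) (hγ : 0 < γ) {X : ℝ} (hX : 0 < X) (k : Fin m) :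
    (weight H a (X • x) k ≠ 0 → (inner ℝ (a k) x) ^ 2 ≤ 4 * σ ^ 2 * γ) ∧
    ((inner ℝ (a k) x) ^ 2 ≤ 4 * σ ^ 2 → weight H a (X • x) k = 1) := by
  set Y := ∑ j, (inner ℝ (a j) x) ^ 2 with hY
  have hm' : (0 : ℝ) < m := Nat.cast_pos.2 hm
  have hYle : Y ≤ 4 * σ ^ 2 * m := sum_sq_le_of_tail hσ hδ (hr.tail x hx.le)
  have hYge : 95 / 100 * m ≤ 4 * σ ^ 2 * Y := by
    refine (hr.lower x hx).trans ?_
    rw [hY, Finset.mul_sum]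
    exact Finset.sum_le_sum fun j _ => mul_le_mul_of_nonneg_right (min_le_right _ _) (sq_nonneg _)
  have hσ2 : 0 < 4 * σ ^ 2 := by positivity
  have hY0 : 0 < Y := by
    by_contra hcon
    have := mul_nonpos_of_nonneg_of_nonpos hσ2.le (not_lt.1 hcon)
    linarith
  have e : weight H a (X • x) k = H (m * (inner ℝ (a k) x) ^ 2 / Y) := by
    unfold weight
    congr 1
    simp only [real_inner_smul_right, mul_pow]
    rw [← Finset.mul_sum, ← hY]
    field_simp
  rw [e]
  refine ⟨fun hne => ?_, fun hs => hH.eq_one _ ?_⟩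
  · have h1 : m * (inner ℝ (a k) x) ^ 2 / Y < γ := by
      by_contra hcon
      exact hne (hH.eq_zero _ (not_lt.1 hcon))
    rw [div_lt_iff₀ hY0] at h1
    have h2 := mul_le_mul_of_nonneg_left hYle hγ.le
    refine le_of_mul_le_mul_left ?_ hm'
    linarith
  · rw [div_le_iff₀ hY0, hβ]
    have h1 := mul_le_mul_of_nonneg_left hs hm'.le
    have h2 := mul_le_mul_of_nonneg_left hYge hσ2.le
    have h3 : 0 ≤ m * σ ^ 2 := by positivity
    -- Since 4σ²Y ≥ 0.95m, the value β = 32σ⁴ leaves a spare factor 2 · 0.95 > 1.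
    have h4 : 32 * σ ^ 4 * Y = 2 * (4 * σ ^ 2 * (4 * σ ^ 2 * Y)) := by ring
    rw [h4]
    linarith

/-- The Hessian of the loss on the event `IsRegular`, for `z` near `x` and `‖x‖ = 1`. -/
theorem IsRegular.le_second_deriv {β γ M : ℝ} {H : ℝ → ℝ} (hH : IsSmoothCutoff β γ M H)
    (hr : IsRegular σ δ x a) (hx : ‖x‖ = 1) (hm : 0 < m) (hσ : 1 ≤ σ) (hδ1 : δ ≤ 1)
    (hβ : β = 32 * σ ^ 4) (hβγ : β < γ)
    (hδ : δ * (64 * σ ^ 2 + 1536 * σ ^ 2 * γ + 250 * M * γ ^ 2 * (4 * σ ^ 2 * γ) ^ 2) ≤ 1 / 4)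
    {X : ℝ} (hX : 0 < X) {z v : EuclideanSpace ℝ (Fin n)} (hz : ‖z - x‖ ≤ 1 / 5)
    (hv : ‖v‖ = 1) :
    1 / 25 * X ^ 2 ≤ fderiv ℝ (fderiv ℝ (cutoffLoss H (weight H a (X • x)) a (X • x)))
      (X • z) v v := by
  have hm' : (0 : ℝ) < m := Nat.cast_pos.2 hm
  have hz1 : 4 / 5 ≤ ‖z‖ := by
    have := norm_sub_norm_le x z
    rw [norm_sub_rev] at this
    linarith
  have hz2 : ‖z‖ ≤ 6 / 5 := by
    have := norm_sub_norm_le z x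
    linarith
  have hz0 : z ≠ 0 := by
    rintro rfl
    rw [norm_zero] at hz1
    linarith
  have hN1 : 16 / 25 ≤ ‖z‖ ^ 2 := by nlinarith
  have hN2 : ‖z‖ ^ 2 ≤ 36 / 25 := by nlinarith [norm_nonneg z]
  have hb : (inner ℝ z v) ^ 2 ≤ ‖z‖ ^ 2 := by
    rw [← sq_abs]
    refine pow_le_pow_left₀ (abs_nonneg _) ?_ 2
    simpa [hv] using abs_real_inner_le_norm z v
  have hγ : 0 < γ := by
    have : 0 < σ ^ 4 := by positivity
    linarith
  obtain ⟨zu, hzu⟩ : ∃ zu, zu = ‖z‖⁻¹ • z := ⟨_, rfl⟩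
  have hzun : ‖zu‖ ≤ 1 := by
    rw [hzu, norm_smul, norm_inv, norm_norm, inv_mul_cancel₀ (norm_ne_zero_iff.2 hz0)]
  -- The radius 1/5 of the region puts e in the unit ball, where the uniform bounds apply.
  obtain ⟨e, he⟩ : ∃ e, e = (5 : ℝ) • (z - x) := ⟨_, rfl⟩
  have hen : ‖e‖ ≤ 1 := by
    rw [he, norm_smul]
    norm_num
    linarith
  have hterm : ∀ k, X ^ 2 * (4 * (min ((inner ℝ (a k) x) ^ 2) (4 * σ ^ 2) * (inner ℝ (a k) v) ^ 2)
        - 16 * σ ^ 2 * ((inner ℝ (a k) v) ^ 2 * bigInd σ (inner ℝ (a k) zu) +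
            (inner ℝ (a k) v) ^ 2 * bigInd σ (inner ℝ (a k) x))
        - 24 / 50 * (huber (2 * σ) (inner ℝ (a k) v) ^ 2 + huber (2 * σ) (inner ℝ (a k) e) ^ 2)
        - 384 * σ ^ 2 * γ * ((inner ℝ (a k) v) ^ 2 * bigInd σ (inner ℝ (a k) v) +
            (inner ℝ (a k) v) ^ 2 * bigInd σ (inner ℝ (a k) e))
        - 100 * M * γ ^ 2 * (4 * σ ^ 2 * γ) ^ 2 * (bigInd σ (inner ℝ (a k) zu) +
            (inner ℝ (a k) v) ^ 2 * bigInd σ (inner ℝ (a k) zu))) ≤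
      termSecond (inner ℝ (a k) (X • z)) (inner ℝ (a k) v) (inner ℝ (a k) (X • x)) (‖X • z‖ ^ 2)
        (inner ℝ (X • z) v)
        (H ((inner ℝ (a k) (X • z)) ^ 2 / ‖X • z‖ ^ 2))
        (deriv H ((inner ℝ (a k) (X • z)) ^ 2 / ‖X • z‖ ^ 2))
        (deriv (deriv H) ((inner ℝ (a k) (X • z)) ^ 2 / ‖X • z‖ ^ 2)) * weight H a (X • x) k := by
    intro k
    obtain ⟨hw1, hw2⟩ := hr.weight_spec hH hx hm hσ hδ1 hβ hγ hX k
    have e1 : ‖X • z‖ ^ 2 = X ^ 2 * ‖z‖ ^ 2 := by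
      rw [norm_smul, mul_pow, Real.norm_eq_abs, sq_abs]
    have e2 : (X * inner ℝ (a k) z) ^ 2 / (X ^ 2 * ‖z‖ ^ 2) = (inner ℝ (a k) z) ^ 2 / ‖z‖ ^ 2 := by
      rw [mul_pow, mul_div_mul_left _ _ (by positivity)]
    rw [e1, real_inner_smul_right _ z, real_inner_smul_right _ x, real_inner_smul_left, e2,
      termSecond_smul hX.ne' (by positivity), mul_assoc (X ^ 2)]
    refine mul_le_mul_of_nonneg_left ?_ (by positivity)
    refine termSecond_lower hH hσ hβ hβγ rfl hN1 hN2 hb ?_ ?_ (hH.nonneg _) (hH.le_one _) hw1 hw2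
    · rw [hzu, real_inner_smul_right, mul_pow, inv_pow]; ring
    · rw [he, real_inner_smul_right, inner_sub_right]; ring
  rw [fderiv_fderiv_cutoffLoss _ a _ hH.differentiable hH.differentiable_deriv
    (smul_ne_zero hX.ne' hz0) hv]
  have hsum := Finset.sum_le_sum fun k (_ : k ∈ Finset.univ) => hterm k
  rw [← Finset.mul_sum] at hsum
  simp only [Finset.sum_sub_distrib, ← Finset.mul_sum, Finset.sum_add_distrib] at hsum
  have b0 := hr.lower v hv
  have b1 := hr.sum_sq_bigInd_le hσ hv.le hzun
  have b2 := hr.sum_sq_bigInd_le hσ hv.le hx.le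
  have b3 := hr.quartic v hv.le
  have b4 := hr.quartic e hen
  have b5 := hr.sum_sq_bigInd_le hσ hv.le hv.le
  have b6 := hr.sum_sq_bigInd_le hσ hv.le hen
  have b7 := hr.sum_bigInd_le hσ hzun
  have hM : 0 ≤ M := (abs_nonneg _).trans (hH.abs_deriv_le 0)
  have c1 := mul_le_mul_of_nonneg_left (add_le_add b1 b2) (by positivity : 0 ≤ 16 * σ ^ 2)
  have c2 := mul_le_mul_of_nonneg_left (add_le_add b5 b6) (by positivity : 0 ≤ 384 * σ ^ 2 * γ)
  have c3 := mul_le_mul_of_nonneg_left (add_le_add b7 b1)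
    (by positivity : 0 ≤ 100 * M * γ ^ 2 * (4 * σ ^ 2 * γ) ^ 2)
  have c4 := mul_le_mul_of_nonneg_right hδ hm'.le
  rw [one_div_mul_eq_div (2 * (m : ℝ)), le_div_iff₀ (by positivity)]
  refine le_trans ?_ hsum
  have e3 : 1 / 25 * X ^ 2 * (2 * (m : ℝ)) = X ^ 2 * (2 / 25 * m) := by ring
  rw [e3]
  refine mul_le_mul_of_nonneg_left ?_ (by positivity)
  -- The balance is 4 · 0.95 - (24/50) · 2 · 3.35 = 0.584. The remaining errors total at most 2 ·
  -- 1/4, and 0.084 ≥ 2/25.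
  linarith

end Regular

/-- Regular samples have overwhelming probability. -/
theorem exists_regular_event {σ δ : ℝ} (hσ : 1 ≤ σ) (hδ1 : δ ≤ 1)
    (hδ : ∫ t, tailSq σ (2 * t) ∂gaussianReal 0 1 < δ)
    (hσ6 : 65 * ∫ t, t ^ 6 ∂gaussianReal 0 1 ≤ 4 * σ ^ 2 / 100) :
    ∃ C c : ℝ, 0 < C ∧ 0 < c ∧ ∀ n m : ℕ, 1 ≤ n → C * n ≤ m →
      ∀ x : EuclideanSpace ℝ (Fin n), ‖x‖ = 1 →
      ∃ B : Set (Fin m → EuclideanSpace ℝ (Fin n)), MeasurableSet B ∧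
        (Measure.pi fun _ : Fin m => stdGaussian (EuclideanSpace ℝ (Fin n))) Bᶜ ≤
          ENNReal.ofReal (Real.exp (-(c * m))) ∧
        ∀ a ∈ B, IsRegular σ δ x a := by
  have hσ0 : 0 < σ := by linarith
  obtain ⟨C₁, c₁, hC₁, hc₁, H₁⟩ := exists_uniform_upper convexOn_tailSq (measurable_tailSq (σ := σ))
    tailSq_nonneg (fun s t => tailSq_mono) one_pos
    (fun t => (tailSq_le_sq hσ0.le t).trans (one_mul _).ge) one_lt_two (sub_pos.2 hδ)
  obtain ⟨C₂, c₂, hC₂, hc₂, H₂⟩ := exists_uniform_upper (convexOn_huber_sq (T := 2 * σ) (by positivity))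
    (measurable_huber.pow_const 2) (fun t => sq_nonneg _)
    (fun s t h => pow_le_pow_left₀ (huber_nonneg (by positivity) s)
      (huber_mono (by positivity) h) 2) (K := 4 * (2 * σ) ^ 2) (by positivity)
    (huber_sq_le (by positivity)) (r := 51 / 50) (δ := 1 / 10) (by norm_num) (by norm_num)
  obtain ⟨C₃, c₃, hC₃, hc₃, H₃⟩ := exists_uniform_lower (τ := 4 * σ ^ 2) (K := 4 * σ ^ 2)
    (by positivity) (by positivity) hσ6
  set c₀ := min c₁ (min c₂ c₃) with hc₀
  have hc0 : 0 < c₀ := lt_min hc₁ (lt_min hc₂ hc₃)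
  have l1 : c₀ ≤ c₁ := min_le_left _ _
  have l2 : c₀ ≤ c₂ := (min_le_right _ _).trans (min_le_left _ _)
  have l3 : c₀ ≤ c₃ := (min_le_right _ _).trans (min_le_right _ _)
  -- The term 4/c₀ ensures c₀m ≥ 4, so exp(c₀m/2) ≥ 3 absorbs the union bound over three events at
  -- half the rate.
  refine ⟨C₁ + C₂ + C₃ + 4 / c₀, c₀ / 2, by positivity, by positivity, ?_⟩
  intro n m hn hnm x hx
  have hn' : (1 : ℝ) ≤ n := Nat.one_le_cast.2 hn
  have hm0 : (0 : ℝ) ≤ m := Nat.cast_nonneg m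
  have p1 : 0 ≤ C₁ * n := by positivity
  have p2 : 0 ≤ C₂ * n := by positivity
  have p3 : 0 ≤ C₃ * n := by positivity
  have p4 : 4 / c₀ ≤ 4 / c₀ * n := le_mul_of_one_le_right (by positivity) hn'
  have hm4 : 4 / c₀ ≤ m := by linarith
  rw [div_le_iff₀ hc0] at hm4
  have p5 : 0 ≤ 4 / c₀ * n := by positivity
  obtain ⟨B₁, hB₁, hP₁, hR₁⟩ := H₁ n m (by linarith)
  obtain ⟨B₂, hB₂, hP₂, hR₂⟩ := H₂ n m (by linarith)
  obtain ⟨B₃, hB₃, hP₃, hR₃⟩ := H₃ n m (by linarith) x hx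
  refine ⟨B₁ ∩ (B₂ ∩ B₃), hB₁.inter (hB₂.inter hB₃), ?_, ?_⟩
  · have hexp : ∀ c, c₀ ≤ c → ENNReal.ofReal (Real.exp (-(c * m))) ≤
        ENNReal.ofReal (Real.exp (-(c₀ * m))) := fun c hc =>
      ENNReal.ofReal_le_ofReal (Real.exp_le_exp.2
        (neg_le_neg (mul_le_mul_of_nonneg_right hc hm0)))
    rw [Set.compl_inter, Set.compl_inter]
    refine (measure_union_le _ _).trans ((add_le_add_right (measure_union_le _ _) _).trans ?_)
    refine (add_le_add (hP₁.trans (hexp _ l1)) (add_le_add (hP₂.trans (hexp _ l2))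
      (hP₃.trans (hexp _ l3)))).trans ?_
    rw [← ENNReal.ofReal_add (by positivity) (by positivity),
      ← ENNReal.ofReal_add (by positivity) (by positivity)]
    refine ENNReal.ofReal_le_ofReal ?_
    have e1 : Real.exp (-(c₀ / 2 * m)) = Real.exp (-(c₀ * m)) * Real.exp (c₀ * m / 2) := by
      rw [← Real.exp_add]; congr 1; ring
    have e2 : 3 ≤ Real.exp (c₀ * m / 2) := by
      have := Real.add_one_le_exp (c₀ * m / 2)
      linarith
    rw [e1]
    have := mul_le_mul_of_nonneg_left e2 (Real.exp_pos (-(c₀ * m))).le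
    linarith
  · intro a ha
    have htail : ∀ v : EuclideanSpace ℝ (Fin n), ‖v‖ ≤ 1 →
        ∑ k, tailSq σ (inner ℝ (a k) v) ≤ δ * m := by
      intro v hv
      refine (hR₁ a ha.1 v hv).trans (le_of_eq (by ring))
    refine ⟨htail, fun v hv => ?_, ?_⟩
    · refine (hR₂ a ha.2.1 v hv).trans ?_
      -- 3 · 1.02⁴ + 0.1 < 3.35.
      have := integral_huber_sq_le (T := 2 * σ) (by positivity) (51 / 50)
      have h2 : ∫ t, huber (2 * σ) (51 / 50 * t) ^ 2 ∂gaussianReal 0 1 + 1 / 10 ≤ 335 / 100 := by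
        norm_num at this ⊢
        linarith
      rw [mul_comm]
      exact mul_le_mul_of_nonneg_right h2 hm0
    · exact hR₃ a ha.2.2 fun w hw => sum_sq_le_of_tail hσ hδ1 (htail w hw)

/-! ### From the quadratic form to eigenvalues and strong convexity. -/

section Conclusion

variable {n m : ℕ} {β γ M σ δ : ℝ} {h : ℝ → ℝ} {x : EuclideanSpace ℝ (Fin n)}
  {a : Fin m → EuclideanSpace ℝ (Fin n)}

lemma loss_neg (h : ℝ → ℝ) (a : Fin m → EuclideanSpace ℝ (Fin n))
    (x : EuclideanSpace ℝ (Fin n)) : loss h a (-x) = loss h a x := by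
  ext z
  simp [loss, measurement]

/-- The Hessian bound for the loss near `x`. -/
theorem IsRegular.loss_bound_of_norm_sub_le (hh : IsActivation β γ M h)
    (hr : IsRegular σ δ (‖x‖⁻¹ • x) a) (hx : x ≠ 0) (hm : 0 < m) (hσ : 1 ≤ σ) (hδ1 : δ ≤ 1)
    (hβ : β = 32 * σ ^ 4) (hβγ : β < γ)
    (hδ : δ * (64 * σ ^ 2 + 1536 * σ ^ 2 * γ + 250 * M * γ ^ 2 * (4 * σ ^ 2 * γ) ^ 2) ≤ 1 / 4)
    {z : EuclideanSpace ℝ (Fin n)} (hz : ‖z - x‖ ≤ 1 / 5 * ‖x‖) :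
    TwiceDifferentiableAt (loss h a x) z ∧
      ∀ v, 1 / 25 * ‖x‖ ^ 2 * ‖v‖ ^ 2 ≤ fderiv ℝ (fderiv ℝ (loss h a x)) z v v := by
  have hβ0 : 0 < β := by rw [hβ]; positivity
  have hH := hh.isSmoothCutoff_extendOne hβ0 hβγ
  have hX : 0 < ‖x‖ := norm_pos_iff.2 hx
  have hz0 : z ≠ 0 := by
    rintro rfl
    rw [zero_sub, norm_neg] at hz
    linarith
  rw [loss_eq_cutoffLoss hβ0 hh]
  refine ⟨twiceDifferentiableAt_cutoffLoss _ _ _ hH.differentiable hH.differentiable_deriv hz0,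
    fun v => ?_⟩
  by_cases hv : v = 0
  · simp [hv]
  have hv0 : 0 < ‖v‖ := norm_pos_iff.2 hv
  have hzs : ‖‖x‖⁻¹ • z - ‖x‖⁻¹ • x‖ ≤ 1 / 5 := by
    rw [← smul_sub, norm_smul, norm_inv, norm_norm, inv_mul_le_iff₀ hX]
    linarith
  have hxu : ‖‖x‖⁻¹ • x‖ = 1 := by rw [norm_smul, norm_inv, norm_norm, inv_mul_cancel₀ hX.ne']
  have hvu : ‖‖v‖⁻¹ • v‖ = 1 := by rw [norm_smul, norm_inv, norm_norm, inv_mul_cancel₀ hv0.ne']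
  have key := hr.le_second_deriv hH hxu hm hσ hδ1 hβ hβγ hδ hX hzs hvu
  rw [smul_inv_smul₀ hX.ne', smul_inv_smul₀ hX.ne'] at key
  simp only [map_smul, _root_.smul_apply, smul_eq_mul] at key
  rw [← mul_assoc, ← sq, inv_pow, inv_mul_eq_div, le_div_iff₀ (by positivity)] at key
  exact key

/-- The conclusions of the main theorem hold for every regular sample. -/
theorem IsRegular.loss_conclusion (hh : IsActivation β γ M h)
    (hr : IsRegular σ δ (‖x‖⁻¹ • x) a) (hx : x ≠ 0) (hm : 0 < m) (hσ : 1 ≤ σ) (hδ1 : δ ≤ 1)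
    (hβ : β = 32 * σ ^ 4) (hβγ : β < γ)
    (hδ : δ * (64 * σ ^ 2 + 1536 * σ ^ 2 * γ + 250 * M * γ ^ 2 * (4 * σ ^ 2 * γ) ^ 2) ≤ 1 / 4) :
    (∀ z ∈ regionOne x, TwiceDifferentiableAt (loss h a x) z ∧ (hessian (loss h a x) z).IsSymm ∧
      1 / 25 * ‖x‖ ^ 2 ≤ lambdaMin (hessian (loss h a x) z)) ∧
    StrongConvexOn (Metric.closedBall x (1 / 5 * ‖x‖)) (1 / 25 * ‖x‖ ^ 2) (loss h a x) ∧
    StrongConvexOn (Metric.closedBall (-x) (1 / 5 * ‖x‖)) (1 / 25 * ‖x‖ ^ 2) (loss h a x) := by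
  have hpos : ∀ z, ‖z - x‖ ≤ 1 / 5 * ‖x‖ → TwiceDifferentiableAt (loss h a x) z ∧
      ∀ v, 1 / 25 * ‖x‖ ^ 2 * ‖v‖ ^ 2 ≤ fderiv ℝ (fderiv ℝ (loss h a x)) z v v :=
    fun z hz => hr.loss_bound_of_norm_sub_le hh hx hm hσ hδ1 hβ hβγ hδ hz
  have hneg : ∀ z, ‖z + x‖ ≤ 1 / 5 * ‖x‖ → TwiceDifferentiableAt (loss h a x) z ∧
      ∀ v, 1 / 25 * ‖x‖ ^ 2 * ‖v‖ ^ 2 ≤ fderiv ℝ (fderiv ℝ (loss h a x)) z v v := by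
    intro z hz
    -- Regularity and the loss are even in x, so the ball around -x needs no separate event.
    have hr' : IsRegular σ δ (‖-x‖⁻¹ • -x) a := by
      rw [norm_neg, smul_neg]; exact hr.neg
    have := hr'.loss_bound_of_norm_sub_le hh (neg_ne_zero.2 hx) hm hσ hδ1 hβ hβγ hδ (z := z)
      (by rw [sub_neg_eq_add, norm_neg]; exact hz)
    rwa [loss_neg, norm_neg] at this
  have hne : NeZero n := ⟨by rintro rfl; exact hx (Subsingleton.elim _ _)⟩
  refine ⟨fun z hz => ?_, strongConvexOn_of_second_deriv (convex_closedBall _ _)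
    (fun z hz => (hpos z (mem_closedBall_iff_norm.1 hz)).1)
    (fun z hz => (hpos z (mem_closedBall_iff_norm.1 hz)).2),
    strongConvexOn_of_second_deriv (convex_closedBall _ _)
    (fun z hz => (hneg z (by simpa using mem_closedBall_iff_norm.1 hz)).1)
    (fun z hz => (hneg z (by simpa using mem_closedBall_iff_norm.1 hz)).2)⟩
  have hmain : TwiceDifferentiableAt (loss h a x) z ∧
      ∀ v, 1 / 25 * ‖x‖ ^ 2 * ‖v‖ ^ 2 ≤ fderiv ℝ (fderiv ℝ (loss h a x)) z v v := by
    rcases min_le_iff.1 (show min ‖z - x‖ ‖z + x‖ ≤ 1 / 5 * ‖x‖ from hz) with h1 | h1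
    · exact hpos z h1
    · exact hneg z h1
  exact ⟨hmain.1, hmain.1.isSymm_hessian, le_lambdaMin_hessian hmain.1 hmain.2⟩

end Conclusion

/-- Transfer of an event from the product Gaussian measure to any independent sample. -/
lemma exists_measurable_event {n m : ℕ} {Ω : Type*} [MeasurableSpace Ω] {P : Measure Ω}
    [IsProbabilityMeasure P] {a : Fin m → Ω → EuclideanSpace ℝ (Fin n)}
    (ha : ∀ k, HasLaw (a k) (stdGaussian (EuclideanSpace ℝ (Fin n))) P) (hi : iIndepFun a P)
    {B : Set (Fin m → EuclideanSpace ℝ (Fin n))} (hB : MeasurableSet B) {p : ℝ} (hp : 0 ≤ p)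
    (hBp : (Measure.pi fun _ : Fin m => stdGaussian (EuclideanSpace ℝ (Fin n))) Bᶜ ≤
      ENNReal.ofReal p) :
    ∃ E : Set Ω, MeasurableSet E ∧ 1 - p ≤ P.real E ∧ ∀ ω ∈ E, (fun k => a k ω) ∈ B := by
  have hae : ∀ k, AEMeasurable (a k) P := fun k => (ha k).aemeasurable
  have hf : AEMeasurable (fun ω k => a k ω) P := aemeasurable_pi_lambda _ hae
  have hmap : P.map (fun ω k => a k ω) =
      Measure.pi fun _ : Fin m => stdGaussian (EuclideanSpace ℝ (Fin n)) := by
    rw [(iIndepFun_iff_map_fun_eq_pi_map hae).1 hi]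
    congr 1
    ext1 k
    exact (ha k).map_eq
  -- The sample is only almost everywhere measurable, so the preimage of B is replaced by a
  -- measurable subset of the same measure.
  obtain ⟨E, hEs, hEm, hEae⟩ := (hf.nullMeasurable hB).exists_measurable_subset_ae_eq
  refine ⟨E, hEm, ?_, fun ω hω => hEs hω⟩
  have h1 : P.real E =
      (Measure.pi fun _ : Fin m => stdGaussian (EuclideanSpace ℝ (Fin n))).real B := by
    rw [measureReal_congr hEae, ← hmap, map_measureReal_apply_of_aemeasurable hf hB]
  have h2 := ENNReal.toReal_le_of_le_ofReal hp hBp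
  have h3 := probReal_compl_eq_one_sub
    (μ := Measure.pi fun _ : Fin m => stdGaussian (EuclideanSpace ℝ (Fin n))) hB
  rw [h1]
  unfold Measure.real at *
  linarith

end PhaseRetrieval

/-! ### Choice of parameters and the theorem. -/

theorem theorem2 (κ : ℝ) (hκ : 1 < κ) (M : ℝ) :
    ∃ β₀ : ℝ, 1 < β₀ ∧ ∀ β γ : ℝ, β₀ ≤ β → γ = κ * β →
      ∃ C c : ℝ, 0 < C ∧ 0 < c ∧
        ∀ h : ℝ → ℝ, PhaseRetrieval.IsActivation β γ M h →
        ∀ (n m : ℕ), C * (n : ℝ) ≤ (m : ℝ) →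
        ∀ x : EuclideanSpace ℝ (Fin n), x ≠ 0 →
        ∀ (Ω : Type*) [MeasurableSpace Ω] (P : Measure Ω) [IsProbabilityMeasure P]
          (a : Fin m → Ω → EuclideanSpace ℝ (Fin n)),
          (∀ k, HasLaw (a k) (stdGaussian (EuclideanSpace ℝ (Fin n))) P) →
          iIndepFun a P →
          ∃ E : Set Ω, MeasurableSet E ∧ 1 - Real.exp (-(c * (m : ℝ))) ≤ P.real E ∧
            ∀ ω ∈ E,
              (∀ z ∈ PhaseRetrieval.regionOne x,
                PhaseRetrieval.TwiceDifferentiableAt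
                    (PhaseRetrieval.loss h (fun k => a k ω) x) z ∧
                  (PhaseRetrieval.hessian (PhaseRetrieval.loss h (fun k => a k ω) x) z).IsSymm ∧
                  1 / 25 * ‖x‖ ^ 2 ≤ PhaseRetrieval.lambdaMin
                    (PhaseRetrieval.hessian (PhaseRetrieval.loss h (fun k => a k ω) x) z)) ∧
              StrongConvexOn (Metric.closedBall x (1 / 5 * ‖x‖)) (1 / 25 * ‖x‖ ^ 2)
                (PhaseRetrieval.loss h (fun k => a k ω) x) ∧
              StrongConvexOn (Metric.closedBall (-x) (1 / 5 * ‖x‖)) (1 / 25 * ‖x‖ ^ 2)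
                (PhaseRetrieval.loss h (fun k => a k ω) x) := by
  set A : ℝ := 2 ^ 26 * (∫ t, t ^ 26 ∂gaussianReal 0 1) + 1 with hA
  have hA1 : 1 ≤ A := by
    have : 0 ≤ ∫ t : ℝ, t ^ 26 ∂gaussianReal 0 1 :=
      integral_nonneg fun t => Even.pow_nonneg (by decide) t
    linarith
  set A6 : ℝ := ∫ t, t ^ 6 ∂gaussianReal 0 1 with hA6
  -- With γ = 32κσ⁴ the error coefficients sum to at most Dσ²⁰.
  set D : ℝ := 64 + 1536 * (32 * κ) + 4000 * |M| * (32 * κ) ^ 4 with hD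
  have hD64 : 64 ≤ D := by
    have h1 : 0 ≤ 1536 * (32 * κ) := by linarith
    have h2 : 0 ≤ 4000 * |M| * (32 * κ) ^ 4 := by positivity
    linarith
  have hAD : 0 < A * D := by positivity
  -- As σ⁴ = β/32, the three terms give in turn σ ≥ 1, AD/σ⁴ ≤ 1/4 and 1625 A6 ≤ σ², which is the
  -- sixth moment condition with τ = 4σ².
  refine ⟨32 * (1 + 4 * (A * D) + (1625 * A6) ^ 2), by nlinarith [sq_nonneg (1625 * A6)], ?_⟩
  intro β γ hβ₀ hγ
  set σ : ℝ := Real.sqrt (Real.sqrt (β / 32)) with hσdef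
  have hβpos : 0 ≤ β / 32 := by nlinarith [sq_nonneg (1625 * A6)]
  have hσ2 : σ ^ 2 = Real.sqrt (β / 32) := Real.sq_sqrt (Real.sqrt_nonneg _)
  have hσ4 : σ ^ 4 = β / 32 := by
    rw [show σ ^ 4 = (σ ^ 2) ^ 2 by ring, hσ2, Real.sq_sqrt hβpos]
  have hσ0 : 0 ≤ σ := Real.sqrt_nonneg _
  have hβσ : β = 32 * σ ^ 4 := by rw [hσ4]; ring
  have hσlarge : 1 + 4 * (A * D) + (1625 * A6) ^ 2 ≤ σ ^ 4 := by rw [hσ4]; linarith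
  have hsq6 := sq_nonneg (1625 * A6)
  have hσ : 1 ≤ σ := by
    by_contra hcon
    have := pow_le_one₀ hσ0 (not_le.1 hcon).le (n := 4)
    linarith
  have hσpos : 0 < σ := by linarith
  have hσA6 : 65 * A6 ≤ 4 * σ ^ 2 / 100 := by
    have : 1625 * A6 ≤ σ ^ 2 := by
      refine le_of_sq_le_sq ?_ (sq_nonneg σ)
      rw [show (σ ^ 2) ^ 2 = σ ^ 4 by ring]
      linarith
    linarith
  -- The added 1 in A makes the tail integral strictly smaller than δ, leaving room for deviations.
  set δ : ℝ := A / σ ^ 24 with hδdef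
  have hAD4 : 4 * (A * D) ≤ σ ^ 4 := by linarith
  have hδ1 : δ ≤ 1 := by
    rw [hδdef, div_le_one (by positivity)]
    have h1 : σ ^ 4 ≤ σ ^ 24 := pow_le_pow_right₀ hσ (by norm_num)
    nlinarith
  have hδint : ∫ t, PhaseRetrieval.tailSq σ (2 * t) ∂gaussianReal 0 1 < δ := by
    refine (PhaseRetrieval.integral_tailSq_le hσpos).trans_lt ?_
    exact div_lt_div_of_pos_right (by linarith) (by positivity)
  have hδ0 : 0 ≤ δ := by positivity
  have hδpoly : δ * (64 * σ ^ 2 + 1536 * σ ^ 2 * γ + 250 * M * γ ^ 2 * (4 * σ ^ 2 * γ) ^ 2)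
      ≤ 1 / 4 := by
    have e1 : 64 * σ ^ 2 + 1536 * σ ^ 2 * γ + 250 * M * γ ^ 2 * (4 * σ ^ 2 * γ) ^ 2 =
        64 * σ ^ 2 + 1536 * (32 * κ) * σ ^ 6 + 4000 * (32 * κ) ^ 4 * (M * σ ^ 20) := by
      rw [hγ, hβσ]; ring
    have e2 : 64 * σ ^ 2 + 1536 * (32 * κ) * σ ^ 6 + 4000 * (32 * κ) ^ 4 * (M * σ ^ 20) ≤
        D * σ ^ 20 := by
      have h1 : σ ^ 2 ≤ σ ^ 20 := pow_le_pow_right₀ hσ (by norm_num)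
      have h2 : σ ^ 6 ≤ σ ^ 20 := pow_le_pow_right₀ hσ (by norm_num)
      have h3 : 1536 * (32 * κ) * σ ^ 6 ≤ 1536 * (32 * κ) * σ ^ 20 :=
        mul_le_mul_of_nonneg_left h2 (by linarith)
      have h4 : 4000 * (32 * κ) ^ 4 * (M * σ ^ 20) ≤ 4000 * (32 * κ) ^ 4 * (|M| * σ ^ 20) := by
        gcongr
        exact le_abs_self M
      rw [hD]
      linarith
    rw [e1]
    refine (mul_le_mul_of_nonneg_left e2 hδ0).trans ?_
    have e3 : δ * (D * σ ^ 20) = A * D / σ ^ 4 := by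
      rw [hδdef]; field_simp
    rw [e3, div_le_iff₀ (by positivity)]
    linarith
  obtain ⟨C, c, hC, hc, hreg⟩ := PhaseRetrieval.exists_regular_event hσ hδ1 hδint hσA6
  refine ⟨C, c, hC, hc, ?_⟩
  intro h hh n m hnm x hx Ω _ P _ a ha hi
  have hn : 1 ≤ n := by
    rcases Nat.eq_zero_or_pos n with rfl | hn
    · exact absurd (Subsingleton.elim x 0) hx
    · exact hn
  have hm : 0 < m := by
    have hn' : (1 : ℝ) ≤ n := Nat.one_le_cast.2 hn
    have : (0 : ℝ) < m := lt_of_lt_of_le (by positivity) hnm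
    exact_mod_cast this
  have hxu : ‖‖x‖⁻¹ • x‖ = 1 := by
    rw [norm_smul, norm_inv, norm_norm, inv_mul_cancel₀ (norm_ne_zero_iff.2 hx)]
  obtain ⟨B, hBm, hBP, hBreg⟩ := hreg n m hn hnm (‖x‖⁻¹ • x) hxu
  obtain ⟨E, hEm, hEP, hEB⟩ := PhaseRetrieval.exists_measurable_event ha hi hBm
    (Real.exp_pos _).le hBP
  have hβpos' : 0 < β := by rw [hβσ]; positivity
  have hβγ : β < γ := by rw [hγ]; exact lt_mul_of_one_lt_left hβpos' hκ
  exact ⟨E, hEm, hEP, fun ω hω =>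
    (hBreg _ (hEB ω hω)).loss_conclusion hh hx hm hσ hδ1 hβσ hβγ hδpoly⟩
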